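/- For a totally ordered abelian group $G$ let $\mathbb{R}((G))$ be the field of generalised series $a=\sum_{g\in G}a_gt^g$ with real coefficients and well-ordered support. Its valuation ring $\mathcal O=\mathbb{R}[[G^{\ge 0}]]$ and maximal ideal $\mathcal M=\mathbb{R}[[G^{>0}]]$ consist of the series with support in $G^{\ge0}$, respectively $G^{>0}$; $y(0)$ is the constant term of $y$. For $y=y(0)+\epsilon\in\mathcal O$ with $\epsilon\in\mathcal M$ put $\exp(y)=e^{y(0)}\sum_{k\ge0}\epsilon^k/k!$. The Hahn group over a totally ordered set $\Phi$ is the group $H(\Phi)$ of families $g=(g_\phi)_{\phi\in\Phi}$ of reals with well-ordered support, ordered lexicographically; $\mathbb 1_\phi\in H(\Phi)$ is $1$ at $\phi$ and $0$ elsewhere. Let $G$ be embedded, as an ordered group, in $H(\Phi)$. A map $D:\mathbb{R}((G))\to\mathbb{R}((G))$ is a series derivation if there are series $L_\phi$ ($\phi\in\Phi$; thus $L_\phi=D(t^{\mathbb 1_\phi})/t^{\mathbb 1_\phi}$ whenever $\mathbb 1_\phi\in G$) such that $D(t^g)=t^g\sum_\phi g_\phi L_\phi$ for all $g\in G$ (strong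 Leibniz rule) and $D(a)=\sum_g a_gD(t^g)$ for all $a$ (strong linearity), all these families being summable. Then the following hold. 1. For every $G$: the series $\sum_k\epsilon^k/k!$ is a summable family for $\epsilon\in\mathcal M$, with sum $\exp(\epsilon)$; $\exp(r+\epsilon)=e^r\exp(\epsilon)$ for $r\in\mathbb R$, $\epsilon\in\mathcal M$; and $\exp(x+y)=\exp(x)\exp(y)$, $\exp(x)\ne0$ for $x,y\in\mathcal O$. 2. Every series derivation $D$ on $\mathbb{R}((G))$ is an $\mathbb{R}$-linear derivation, and $D(y)=D(\exp(y))/\exp(y)$ for all $y\in\mathcal O$. 3. For every $G$, every $n\ge1$ and all $y_1,\dots,y_n\in\mathcal O$ such that $y_1-y_1(0),\dots,y_n-y_n(0)$ are $\mathbb Q$-linearly independent, $$\mathrm{td}_{\mathbb R}\,\mathbb R(y_1,\dots,y_n,\exp(y_1),\dots,\exp(y_n))\ge n+1 .$$ 4. Let $G=H(\Phi)$. In each of the following cases there is exactly one series derivation $D$ on $\mathbb{R}((G))$ with $D(t^{\mathbb 1_\phi})/t^{\mathbb 1_\phi}=t^{\theta(\phi)}$ for all $\phi\in\Phi$; it is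 a derivation, satisfies $D(t^g)=\sum_\phi g_\phi t^{g+\theta(\phi)}$ for all $g\in G$, and its field of constants is $\mathbb R$. * Case 1: $\theta(\phi)=-\mathbb 1_{\sigma(\phi)}$, where $\sigma:\Phi\to\Phi$ is strictly increasing with $\sigma(\phi)>\phi$ for all $\phi$. * Case 2(a): $\theta(\phi)=f(\phi)\mathbb 1_{\phi_M}$, where $f:\Phi\to\mathbb R$ is strictly increasing and $\phi_M=\max\Phi$. * Case 2(b): $\Phi$ has no greatest element, $f:\Phi\to\mathbb R_{<0}$ is strictly increasing, $(\phi_n)_{n\ge0}$ is a strictly increasing cofinal sequence in $\Phi$, and $\theta(\phi)=f(\phi)\mathbb 1_{\phi_{n+1}}$ for $\phi\in[\phi_n,\phi_{n+1})$ (and $\theta(\phi)=f(\phi)\mathbb 1_{\phi_1}$ for $\phi<\phi_0$). Such $f$ and $(\phi_n)$ exist for every non-empty $\Phi$ without greatest element that is order-isomorphic to a subset of $\mathbb R$. -/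

import Mathlib

universe u v

namespace GenSeries

/-- The Hahn group over a totally ordered set `Φ`: the families `(g_φ)` of real numbers with
well-ordered support, ordered lexicographically (the least index at which two families differ
decides). -/
abbrev HahnGroup (Φ : Type*) [LinearOrder Φ] : Type _ := Lex (HahnSeries Φ ℝ)

/-- The element of the Hahn group with the value `r` at `φ` and `0` elsewhere. -/
noncomputable def atom {Φ : Type*} [LinearOrder Φ] (φ : Φ) (r : ℝ) : HahnGroup Φ :=
  toLex (HahnSeries.single φ r)

/-- The field `ℝ((G))` of generalised series. -/
abbrev Series (G : Type*) [AddCommGroup G] [LinearOrder G] [IsOrderedAddMonoid G] : Type _ :=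
  HahnSeries G ℝ

section

variable {G : Type*} [AddCommGroup G] [LinearOrder G] [IsOrderedAddMonoid G]

/-- The monomial `t ^ g`. -/
noncomputable def mono (g : G) : Series G := HahnSeries.single g 1

/-- The family `f` of series is summable (the union of the supports is well-ordered and each
exponent lies in only finitely many of the supports), and its sum is `x`. -/
def HasSeriesSum {α : Type*} (f : α → Series G) (x : Series G) : Prop :=
  ∃ s : HahnSeries.SummableFamily G ℝ α, (∀ a, s a = f a) ∧ s.hsum = x

/-- The valuation ring `ℝ[[G^{≥ 0}]]`: no exponent in the support is negative. -/
def InValuationRing (y : Series G) : Prop := ∀ g ∈ y.support, 0 ≤ g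

/-- The maximal ideal `ℝ[[G^{> 0}]]`: all exponents in the support are positive. -/
def Infinitesimal (y : Series G) : Prop := ∀ g ∈ y.support, 0 < g

/-- The sum `∑ ε ^ k / k!`, for infinitesimal `ε`. -/
noncomputable def expInf (ε : Series G) : Series G :=
  (HahnSeries.SummableFamily.smulFamily (fun k : ℕ => ((k.factorial : ℕ) : ℝ)⁻¹)
    (HahnSeries.SummableFamily.powers ε)).hsum

/-- The exponential `exp (y(0) + ε) = exp (y(0)) * exp ε` of an element of the valuation ring. -/
noncomputable def sexp (y : Series G) : Series G :=
  HahnSeries.C (Real.exp (y.coeff 0)) * expInf (y - HahnSeries.C (y.coeff 0))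

/-- Series derivations on `ℝ((G))`, where `G` is embedded in the Hahn group over `Φ` by `ι`.
`L φ` is the logarithmic derivative of the fundamental monomial with index `φ`: if
`ι g = atom φ 1` then the first clause says `D (t ^ g) = t ^ g * L φ`.
The clauses are the strong Leibniz rule and strong linearity, including the summability of the
families that occur in them. -/
def IsSeriesDerivation {Φ : Type*} [LinearOrder Φ] (ι : G →+o HahnGroup Φ)
    (D : Series G → Series G) : Prop :=
  ∃ L : Φ → Series G,
    (∀ g : G, ∃ S : Series G,
      HasSeriesSum (fun φ : Φ => (ofLex (ι g)).coeff φ • L φ) S ∧ D (mono g) = mono g * S) ∧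
    ∀ a : Series G, HasSeriesSum (fun g : G => a.coeff g • D (mono g)) (D a)

end

/-- The prescription `D (t ^ 1_φ) / t ^ 1_φ = t ^ (θ φ)` for all `φ` extends, through the strong
Leibniz rule and strong linearity, to exactly one map on `ℝ((G))`, `G` the Hahn group over `Φ`;
this map is a derivation, and its constants are exactly the real numbers. -/
def ExtendsToSeriesDerivation {Φ : Type*} [LinearOrder Φ] (θ : Φ → HahnGroup Φ) : Prop :=
  ∃ D : Derivation ℝ (Series (HahnGroup Φ)) (Series (HahnGroup Φ)),
    IsSeriesDerivation (OrderAddMonoidHom.id (HahnGroup Φ)) D ∧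
    (∀ φ, D (mono (atom φ 1)) / mono (atom φ 1) = mono (θ φ)) ∧
    (∀ g : HahnGroup Φ,
      HasSeriesSum (fun φ : Φ => (ofLex g).coeff φ • mono (g + θ φ)) (D (mono g))) ∧
    (∀ x, D x = 0 ↔ ∃ r : ℝ, x = HahnSeries.C r) ∧
    ∀ D' : Series (HahnGroup Φ) → Series (HahnGroup Φ),
      IsSeriesDerivation (OrderAddMonoidHom.id (HahnGroup Φ)) D' →
      (∀ φ, D' (mono (atom φ 1)) / mono (atom φ 1) = mono (θ φ)) → D' = D

/-- For a strictly increasing cofinal sequence `u`: the right end point `u (n + 1)` of the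
interval that contains `φ`, among `(-∞, u 1)`, `[u 1, u 2)`, `[u 2, u 3)`, ... -/
noncomputable def rightEnd {Φ : Type*} [LinearOrder Φ] (u : ℕ → Φ) (φ : Φ) : Φ :=
  u (sInf {n : ℕ | φ < u (n + 1)} + 1)

theorem rightEnd_eq {Φ : Type*} [LinearOrder Φ] {u : ℕ → Φ} (hu : StrictMono u) {φ : Φ} {n : ℕ}
    (h₁ : n = 0 ∨ u n ≤ φ) (h₂ : φ < u (n + 1)) : rightEnd u φ = u (n + 1) := by
  have hle : sInf {n : ℕ | φ < u (n + 1)} ≤ n := Nat.sInf_le h₂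
  have hmem : φ < u (sInf {n : ℕ | φ < u (n + 1)} + 1) := Nat.sInf_mem (s := {n | φ < u (n + 1)}) ⟨n, h₂⟩
  have : sInf {n : ℕ | φ < u (n + 1)} = n := by
    rcases h₁ with h | h
    · omega
    · have := hu.lt_iff_lt.1 (lt_of_le_of_lt h hmem)
      omega
  rw [rightEnd, this]

end GenSeries

/-!
Three ideas carry the proof.

*Strong linearity.* A strongly linear map commutes with all summable families
(`IsStronglyLinear.map_hasSeriesSum`). Hence the Leibniz rule for monomials, which is what the strong
Leibniz rule gives, extends to products of series (`IsStronglyLinear.leibniz`), and `D` may be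
applied term by term to the exponential series, so that `D (exp y) = exp y * D y`
(`IsStronglyLinear.map_sexp`). The functional equation of `exp` is the binomial theorem together
with the product of two summable families (`expInf_add`).

*Derivations over a Hahn group.* The three choices of `θ` have in common that `θ` is strictly
increasing and that `θ φ`, `θ ψ` agree at all indices up to `ψ` whenever `ψ < φ` (`IsAdmissible`).
By the convexity of the lexicographic order this makes the families `a_g g_φ t ^ (g + θ φ)` summable
(`IsAdmissible.exists_lt`), and `g + θ (v g)`, with `v g` the least index in the support of `g`, is a
strictly increasing function of `g ≠ 0` (`IsAdmissible.add_lt_add`). The latter shows that the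
leading term of a series without constant term survives differentiation, so all constants are real.

*Transcendence.* For a homomorphism `l : G → ℝ` the Euler derivation `t ^ g ↦ l g • t ^ g` is strongly
linear. The `ℚ`-linear independence of the `y_i - y_i(0)` provides for each of the countably many
nonzero integral combinations of the `y_i` a nonzero exponent in its support; with `l` nonzero at
these exponents, the `D y_i` are linearly independent over `ℤ`. It remains to prove Ax's theorem for
a single derivation `D` of a field `K` (`Derivation.card_add_one_le_trdeg`). If the transcendence
degree of a field `L` that contains the `y_i` and the `z_i = exp y_i` is at most `n`, then the
derivations of `K`, restricted to `L`, form a space of dimension at most `n` on which the `n` forms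
`ω_i = d z_i / z_i - d y_i` have the common nontrivial zero `D`; so the `ω_i` satisfy a linear
relation over `K`. The Lie derivative along `D` kills each `ω_i`, so a relation of minimal support
has constant coefficients (`Derivation.exists_constant_vector`). Such a relation says that a
combination of logarithmic differentials `d w_j / w_j`, with coefficients that are linearly
independent over `ℤ`, is exact. This is impossible by residues
(`Derivation.eq_zero_of_constant_relation`): some `w_j` is transcendental over the constants, `K` is
algebraic over a field `E(w_j)` in which the residue of `d w_j / w_j` at `0` is `1`, and traces and
norms carry the relation down to `E(w_j)`, where an exact form has residue `0`.
-/

/-! ### Summable families and the exponential -/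

namespace GenSeries

open HahnSeries Function

section Sums

variable {G : Type*} [AddCommGroup G] [LinearOrder G] [IsOrderedAddMonoid G]
variable {α β : Type*} {f f' : α → Series G} {x y : Series G}

theorem HasSeriesSum.of_coeff (h₁ : (⋃ a, (f a).support).IsPWO)
    (h₂ : ∀ g, {a | (f a).coeff g ≠ 0}.Finite) (h₃ : ∀ g, x.coeff g = ∑ᶠ a, (f a).coeff g) :
    HasSeriesSum f x :=
  ⟨⟨f, h₁, h₂⟩, fun _ => rfl, by ext g; rw [SummableFamily.coeff_hsum, h₃]; rfl⟩

theorem HasSeriesSum.isPWO (h : HasSeriesSum f x) : (⋃ a, (f a).support).IsPWO := by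
  obtain ⟨s, hs, -⟩ := h
  simpa only [hs] using s.isPWO_iUnion_support

theorem HasSeriesSum.finite (h : HasSeriesSum f x) (g : G) : {a | (f a).coeff g ≠ 0}.Finite := by
  obtain ⟨s, hs, -⟩ := h
  simp only [← hs]
  exact s.finite_co_support g

theorem HasSeriesSum.coeff (h : HasSeriesSum f x) (g : G) :
    x.coeff g = ∑ᶠ a, (f a).coeff g := by
  obtain ⟨s, hs, rfl⟩ := h
  simp only [SummableFamily.coeff_hsum, hs]

theorem HasSeriesSum.unique (h : HasSeriesSum f x) (h' : HasSeriesSum f y) : x = y := by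
  ext g
  rw [h.coeff, h'.coeff]

theorem HasSeriesSum.congr (h : HasSeriesSum f x) (hf : ∀ a, f a = f' a) : HasSeriesSum f' x := by
  rwa [show f' = f from (funext hf).symm]

theorem HasSeriesSum.add (h : HasSeriesSum f x) (h' : HasSeriesSum f' y) :
    HasSeriesSum (fun a => f a + f' a) (x + y) := by
  obtain ⟨s, hs, rfl⟩ := h
  obtain ⟨s', hs', rfl⟩ := h'
  exact ⟨s + s', fun a => by simp [hs, hs'], SummableFamily.hsum_add⟩

theorem HasSeriesSum.mul {f' : β → Series G} (h : HasSeriesSum f x) (h' : HasSeriesSum f' y) :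
    HasSeriesSum (fun p : α × β => f p.1 * f' p.2) (x * y) := by
  obtain ⟨s, hs, rfl⟩ := h
  obtain ⟨s', hs', rfl⟩ := h'
  exact ⟨s.mul s', fun a => by simp [hs, hs'], SummableFamily.hsum_mul _ _⟩

theorem HasSeriesSum.mul_left (h : HasSeriesSum f x) (z : Series G) :
    HasSeriesSum (fun a => z * f a) (z * x) := by
  obtain ⟨s, hs, rfl⟩ := h
  refine ⟨z • s, fun a => ?_, SummableFamily.hsum_smul⟩
  rw [SummableFamily.smul_apply, hs]
  rfl

/-- Zero terms may be added to a summable family. -/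
theorem HasSeriesSum.extend (e : α ↪ β) {f' : β → Series G} (h : HasSeriesSum f x)
    (he : ∀ a, f' (e a) = f a) (h0 : ∀ b ∉ Set.range e, f' b = 0) : HasSeriesSum f' x := by
  obtain ⟨s, hs, rfl⟩ := h
  refine ⟨s.embDomain e, fun b => ?_, SummableFamily.hsum_embDomain _ _⟩
  by_cases hb : b ∈ Set.range e
  · obtain ⟨a, rfl⟩ := hb
    rw [SummableFamily.embDomain_image, he, hs]
  · rw [SummableFamily.embDomain_of_notMem_range _ _ hb, h0 b hb]

theorem HasSeriesSum.of_single {a : α} (h : ∀ b, b ≠ a → f b = 0) : HasSeriesSum f (f a) := by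
  refine .of_coeff ?_ (fun g => (Set.finite_singleton a).subset fun b hb => ?_) fun g => ?_
  · refine (f a).isPWO_support.mono (Set.iUnion_subset fun b => ?_)
    obtain rfl | hb := eq_or_ne b a
    · rfl
    · simp [h b hb]
  · by_contra hba
    simp [h b hba] at hb
  · exact (finsum_eq_single (fun b => (f b).coeff g) a fun b hb => by simp [h b hb]).symm

theorem coeff_mono (g k : G) [Decidable (k = g)] : (mono g).coeff k = if k = g then 1 else 0 := by
  simp [mono, coeff_single]

theorem mono_mul_mono (g h : G) : mono g * mono h = mono (g + h) := by
  simp [mono]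

theorem mono_ne_zero (g : G) : mono g ≠ 0 := by simp [mono]

theorem hasSeriesSum_mono (a : Series G) : HasSeriesSum (fun g => a.coeff g • mono g) a := by
  classical
  refine .of_coeff (a.isPWO_support.mono (Set.iUnion_subset fun g k hk => ?_))
    (fun k => (Set.finite_singleton k).subset fun g hg => ?_) fun k => ?_
  · by_cases hkg : k = g
    · subst hkg
      intro h
      simp [h] at hk
    · simp [coeff_mono, hkg] at hk
  · by_contra hkg
    simp [coeff_mono, Ne.symm hkg] at hg
  · rw [finsum_eq_single _ k fun g hg => by simp [coeff_mono, Ne.symm hg]]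
    simp [coeff_mono]

end Sums

section Exp

variable {G : Type*} [AddCommGroup G] [LinearOrder G] [IsOrderedAddMonoid G]
variable {x y ε δ : Series G}

theorem Infinitesimal.orderTop_pos (h : Infinitesimal ε) : 0 < ε.orderTop := by
  obtain rfl | hε := eq_or_ne ε 0
  · simp
  · rw [orderTop_of_ne_zero hε, ← WithTop.coe_zero, WithTop.coe_lt_coe]
    exact h _ (Set.IsWF.min_mem _ _)

theorem Infinitesimal.coeff_zero (h : Infinitesimal ε) : ε.coeff 0 = 0 := by
  by_contra h0
  exact lt_irrefl _ (h 0 h0)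

theorem Infinitesimal.add (hε : Infinitesimal ε) (hδ : Infinitesimal δ) :
    Infinitesimal (ε + δ) := fun g hg => by
  rcases support_add_subset _ _ hg with h | h
  exacts [hε g h, hδ g h]

theorem InValuationRing.neg (hx : InValuationRing x) : InValuationRing (-x) := fun g hg =>
  hx g (by simpa using hg)

theorem InValuationRing.infinitesimal_sub (hx : InValuationRing x) :
    Infinitesimal (x - C (x.coeff 0)) := fun g hg => by
  have h0 : g ≠ 0 := by
    rintro rfl
    simp [C_apply] at hg
  refine lt_of_le_of_ne (hx g ?_) h0.symm
  simpa [C_apply, coeff_single_of_ne h0] using hg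

theorem Infinitesimal.hasSeriesSum_expInf (h : Infinitesimal ε) :
    HasSeriesSum (fun k : ℕ => ((k.factorial : ℕ) : ℝ)⁻¹ • ε ^ k) (expInf ε) :=
  ⟨_, fun k => by simp [SummableFamily.powers_of_orderTop_pos h.orderTop_pos], rfl⟩

theorem sexp_C_add (r : ℝ) (h : Infinitesimal ε) : sexp (C r + ε) = C (Real.exp r) * expInf ε := by
  have : (C r + ε).coeff 0 = r := by simp [C_apply, h.coeff_zero]
  rw [sexp, this, add_sub_cancel_left]

theorem Infinitesimal.sexp_eq (h : Infinitesimal ε) : sexp ε = expInf ε := by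
  simpa using sexp_C_add 0 h

theorem inv_factorial_smul_add_pow (a b : Series G) (n : ℕ) :
    ((n.factorial : ℕ) : ℝ)⁻¹ • (a + b) ^ n = ∑ p ∈ Finset.HasAntidiagonal.antidiagonal n,
      (((p.1.factorial : ℕ) : ℝ)⁻¹ • a ^ p.1) * (((p.2.factorial : ℕ) : ℝ)⁻¹ • b ^ p.2) := by
  rw [add_pow, Finset.Nat.sum_antidiagonal_eq_sum_range_succ_mk, Finset.smul_sum]
  refine Finset.sum_congr rfl fun k hk => ?_
  have hk : k ≤ n := Nat.lt_succ_iff.1 (Finset.mem_range.1 hk)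
  have hC : C ((n.factorial : ℝ)⁻¹) * (n.choose k : Series G)
      = C ((k.factorial : ℝ)⁻¹) * C (((n - k).factorial : ℝ)⁻¹) := by
    rw [← map_natCast (C : ℝ →+* Series G), ← map_mul, ← map_mul, Nat.cast_choose ℝ hk]
    congr 1
    have := Nat.factorial_ne_zero n
    field_simp
  simp only [← C_mul_eq_smul]
  linear_combination a ^ k * b ^ (n - k) * hC

theorem expInf_add (hε : Infinitesimal ε) (hδ : Infinitesimal δ) :
    expInf (ε + δ) = expInf ε * expInf δ := by
  have h := hε.hasSeriesSum_expInf.mul hδ.hasSeriesSum_expInf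
  have h' := (hε.add hδ).hasSeriesSum_expInf
  ext g
  rw [h.coeff, h'.coeff]
  set F : ℕ × ℕ → ℝ := fun p => ((((p.1.factorial : ℕ) : ℝ)⁻¹ • ε ^ p.1) *
    (((p.2.factorial : ℕ) : ℝ)⁻¹ • δ ^ p.2)).coeff g with hF
  have hfin : (support F).Finite := h.finite g
  have hn : ∀ n : ℕ, (((n.factorial : ℕ) : ℝ)⁻¹ • (ε + δ) ^ n).coeff g
      = ∑ p ∈ Finset.HasAntidiagonal.antidiagonal n, F p := fun n => by
    rw [inv_factorial_smul_add_pow, coeff_sum]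
  simp only [hn]
  obtain ⟨N, hN⟩ : ∃ N, ∀ p ∈ support F, p.1 + p.2 < N := by
    obtain ⟨N, hN⟩ := (hfin.image fun p => p.1 + p.2).bddAbove
    exact ⟨N + 1, fun p hp => Nat.lt_succ_of_le (hN ⟨p, hp, rfl⟩)⟩
  rw [finsum_eq_sum_of_support_subset (s := Finset.range N), Finset.sum_sigma',
    finsum_eq_sum_of_support_subset
      (s := ((Finset.range N).sigma Finset.HasAntidiagonal.antidiagonal).image Sigma.snd),
    Finset.sum_image]
  · rintro ⟨n, p⟩ hp ⟨m, q⟩ hq (rfl : p = q)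
    simp only [Finset.coe_sigma, Set.mem_sigma_iff, Finset.mem_coe, Finset.HasAntidiagonal.mem_antidiagonal]
      at hp hq
    rw [← hp.2, ← hq.2]
  · intro p hp
    simpa using hN p hp
  · intro n hn
    obtain ⟨p, hp, hp'⟩ := Finset.exists_ne_zero_of_sum_ne_zero hn
    simpa [← Finset.HasAntidiagonal.mem_antidiagonal.1 hp] using hN p hp'

theorem sexp_add (hx : InValuationRing x) (hy : InValuationRing y) :
    sexp (x + y) = sexp x * sexp y := by
  have hxy : x + y - C ((x + y).coeff 0) = (x - C (x.coeff 0)) + (y - C (y.coeff 0)) := by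
    rw [coeff_add, map_add]
    ring
  rw [sexp, hxy, expInf_add hx.infinitesimal_sub hy.infinitesimal_sub, coeff_add, Real.exp_add,
    map_mul, sexp, sexp]
  ring

theorem sexp_zero : sexp (0 : Series G) = 1 := by
  have h0 : Infinitesimal (0 : Series G) := fun g hg => by simp at hg
  have h : sexp (0 : Series G) * sexp 0 = sexp 0 := by
    rw [← sexp_add (fun g hg => (h0 g hg).le) (fun g hg => (h0 g hg).le), add_zero]
  have h1 : expInf (0 : Series G) = 1 := by
    have := HasSeriesSum.of_single (a := 0)
      (f := fun k : ℕ => ((k.factorial : ℕ) : ℝ)⁻¹ • (0 : Series G) ^ k)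
      fun k hk => by simp [hk]
    simpa using h0.hasSeriesSum_expInf.unique this
  rw [h0.sexp_eq, h1]

theorem sexp_ne_zero (hx : InValuationRing x) : sexp x ≠ 0 := by
  intro h
  have := sexp_add hx hx.neg
  rw [h, add_neg_cancel, sexp_zero, zero_mul] at this
  exact one_ne_zero this

end Exp

end GenSeries

/-! ### Strongly linear maps and series derivations -/

namespace GenSeries

open HahnSeries Function

section Derivations

variable {G : Type*} [AddCommGroup G] [LinearOrder G] [IsOrderedAddMonoid G]
variable {D : Series G → Series G}

theorem add_smul_series (r s : ℝ) (x : Series G) : (r + s) • x = r • x + s • x := by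
  ext g
  simp [add_mul]

/-- Strong linearity: `D a = ∑ a_g D (t ^ g)`, where the family on the right is summable. -/
def IsStronglyLinear (D : Series G → Series G) : Prop :=
  ∀ a : Series G, HasSeriesSum (fun g : G => a.coeff g • D (mono g)) (D a)

theorem IsStronglyLinear.coeff (hD : IsStronglyLinear D) (a : Series G) (m : G) :
    (D a).coeff m = ∑ᶠ g, a.coeff g * (D (mono g)).coeff m := by
  simpa using (hD a).coeff m

theorem IsStronglyLinear.finite (hD : IsStronglyLinear D) (a : Series G) (m : G) :
    {g | a.coeff g * (D (mono g)).coeff m ≠ 0}.Finite := by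
  simpa using (hD a).finite m

theorem IsStronglyLinear.map_add (hD : IsStronglyLinear D) (a b : Series G) :
    D (a + b) = D a + D b :=
  (hD (a + b)).unique (((hD a).add (hD b)).congr fun g => by
    rw [coeff_add, add_smul_series])

theorem IsStronglyLinear.map_smul (hD : IsStronglyLinear D) (r : ℝ) (a : Series G) :
    D (r • a) = r • D a := by
  ext m
  rw [hD.coeff, HahnSeries.coeff_smul, hD.coeff, smul_eq_mul, mul_finsum]
  simp [mul_assoc]

/-- A strongly linear map commutes with sums of summable families. Finiteness at a given
exponent comes from applying `D` to the indicator series of the union of the supports. -/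
theorem IsStronglyLinear.map_hasSeriesSum (hD : IsStronglyLinear D) {α : Type*}
    {f : α → Series G} {x : Series G} (h : HasSeriesSum f x) :
    HasSeriesSum (fun a => D (f a)) (D x) := by
  classical
  let w : Series G := ⟨Set.indicator (⋃ a, (f a).support) 1,
    h.isPWO.mono (Set.support_indicator_subset)⟩
  have hw : ∀ {a g}, (f a).coeff g ≠ 0 → w.coeff g = 1 := fun {a g} hg =>
    Set.indicator_of_mem (Set.mem_iUnion.2 ⟨a, hg⟩) _
  have hpair : ∀ m, {p : α × G | (f p.1).coeff p.2 * (D (mono p.2)).coeff m ≠ 0}.Finite := by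
    intro m
    refine ((hD.finite w m).biUnion fun g _ => (h.finite g).image fun a => (a, g)).subset ?_
    rintro ⟨a, g⟩ hp
    have h1 : (f a).coeff g ≠ 0 := left_ne_zero_of_mul hp
    have h2 : (D (mono g)).coeff m ≠ 0 := right_ne_zero_of_mul hp
    refine Set.mem_biUnion (x := g) ?_ ⟨a, h1, rfl⟩
    simpa [hw h1] using h2
  have hne : ∀ {a m}, (D (f a)).coeff m ≠ 0 →
      ∃ g, (f a).coeff g * (D (mono g)).coeff m ≠ 0 := fun {a m} ha => by
    rw [hD.coeff] at ha
    by_contra! h0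
    exact ha (finsum_eq_zero_of_forall_eq_zero h0)
  refine .of_coeff ((hD w).isPWO.mono ?_) (fun m => ?_) fun m => ?_
  · refine Set.iUnion_subset fun a m ha => ?_
    obtain ⟨g, hg⟩ := hne ha
    refine Set.mem_iUnion.2 ⟨g, ?_⟩
    simpa [hw (left_ne_zero_of_mul hg)] using right_ne_zero_of_mul hg
  · refine ((hpair m).image Prod.fst).subset fun a ha => ?_
    obtain ⟨g, hg⟩ := hne ha
    exact ⟨(a, g), hg, rfl⟩
  · have hswap : HasFiniteSupport fun p : G × α => (f p.2).coeff p.1 * (D (mono p.1)).coeff m :=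
      ((hpair m).image Prod.swap).subset fun p hp => ⟨p.swap, hp, p.swap_swap⟩
    rw [hD.coeff, finsum_congr fun a => hD.coeff (f a) m, ← finsum_curry _ (hpair m),
      ← finsum_comp_equiv (Equiv.prodComm G α)]
    simp only [Equiv.prodComm_apply, Prod.fst_swap, Prod.snd_swap]
    rw [finsum_curry _ hswap]
    refine finsum_congr fun g => ?_
    rw [h.coeff, finsum_mul]

/-- The Leibniz rule for monomials extends to all series: the products `t ^ g * t ^ h` that occur
in `a * b` form a summable family. -/
theorem IsStronglyLinear.leibniz (hD : IsStronglyLinear D)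
    (h : ∀ g k, D (mono (g + k)) = mono g * D (mono k) + mono k * D (mono g)) (a b : Series G) :
    D (a * b) = a * D b + b * D a := by
  have h1 := hD.map_hasSeriesSum ((hasSeriesSum_mono a).mul (hasSeriesSum_mono b))
  have h2 := (((hasSeriesSum_mono a).mul (hD b)).add ((hD a).mul (hasSeriesSum_mono b)))
  rw [mul_comm b]
  refine h1.unique (h2.congr fun p => ?_)
  have : (a.coeff p.1 • mono p.1) * (b.coeff p.2 • mono p.2)
      = (a.coeff p.1 * b.coeff p.2) • (mono (p.1 + p.2) : Series G) := by
    simp only [← C_mul_eq_smul, ← mono_mul_mono, map_mul]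
    ring
  rw [this, hD.map_smul, h]
  simp only [← C_mul_eq_smul, map_mul]
  ring

/-- The `ℝ`-derivation given by a strongly linear map with the Leibniz rule for monomials. -/
noncomputable def IsStronglyLinear.toDerivation (hD : IsStronglyLinear D)
    (h : ∀ g k, D (mono (g + k)) = mono g * D (mono k) + mono k * D (mono g)) :
    Derivation ℝ (Series G) (Series G) :=
  Derivation.mk' { toFun := D, map_add' := hD.map_add, map_smul' := hD.map_smul }
    fun a b => hD.leibniz h a b

@[simp]
theorem IsStronglyLinear.toDerivation_apply (hD : IsStronglyLinear D)
    (h : ∀ g k, D (mono (g + k)) = mono g * D (mono k) + mono k * D (mono g)) (x : Series G) :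
    hD.toDerivation h x = D x := rfl

theorem IsSeriesDerivation.isStronglyLinear {Φ : Type*} [LinearOrder Φ] {ι : G →+o HahnGroup Φ}
    (hD : IsSeriesDerivation ι D) : IsStronglyLinear D := by
  obtain ⟨L, -, h⟩ := hD
  exact h

theorem IsSeriesDerivation.map_mono_add {Φ : Type*} [LinearOrder Φ] {ι : G →+o HahnGroup Φ}
    (hD : IsSeriesDerivation ι D) (g k : G) :
    D (mono (g + k)) = mono g * D (mono k) + mono k * D (mono g) := by
  obtain ⟨L, h, -⟩ := hD
  obtain ⟨S, hS, hg⟩ := h g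
  obtain ⟨T, hT, hk⟩ := h k
  obtain ⟨U, hU, hgk⟩ := h (g + k)
  have : U = S + T := hU.unique ((hS.add hT).congr fun φ => by
    simp [add_smul_series])
  rw [hgk, hg, hk, this, ← mono_mul_mono]
  ring

theorem map_C_eq_zero (δ : Derivation ℝ (Series G) (Series G)) (r : ℝ) : δ (C r) = 0 := by
  rw [C_eq_algebraMap]
  exact δ.map_algebraMap r

/-- A strongly linear derivation satisfies `D (exp y) = exp y * D y`: it may be applied term by
term to the exponential series. -/
theorem IsStronglyLinear.map_sexp {δ : Derivation ℝ (Series G) (Series G)}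
    (hδ : IsStronglyLinear δ) {y : Series G} (hy : InValuationRing y) :
    δ (sexp y) = sexp y * δ y := by
  set ε := y - C (y.coeff 0) with hε
  have hsum := hy.infinitesimal_sub.hasSeriesSum_expInf
  have h1 := hδ.map_hasSeriesSum hsum
  have h2 : HasSeriesSum (fun k : ℕ => δ (((k.factorial : ℕ) : ℝ)⁻¹ • ε ^ k))
      (δ ε * expInf ε) := by
    -- The term with index `k + 1` of the derived series is `δ ε` times the term with index `k` of
    -- the exponential series, and the term with index `0` vanishes.
    refine (hsum.mul_left (δ ε)).extend ⟨Nat.succ, Nat.succ_injective⟩ (fun k => ?_) fun k hk => ?_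
    · have hC : C (((k + 1).factorial : ℝ)⁻¹) * ((k + 1 : ℕ) : Series G)
          = C ((k.factorial : ℝ)⁻¹) := by
        rw [← map_natCast (C : ℝ →+* Series G), ← map_mul, Nat.factorial_succ]
        congr 1
        have := Nat.factorial_ne_zero k
        have := Nat.cast_add_one_ne_zero (R := ℝ) k
        push_cast
        field_simp
      simp only [Embedding.coeFn_mk, Nat.succ_eq_add_one]
      rw [δ.map_smul, δ.leibniz_pow, Nat.add_sub_cancel, nsmul_eq_mul]
      simp only [← C_mul_eq_smul, smul_eq_mul]
      linear_combination ε ^ k * δ ε * hC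
    · obtain rfl : k = 0 := by
        by_contra h0
        exact hk ⟨k - 1, Nat.succ_pred_eq_of_ne_zero h0⟩
      simp
  have h3 : δ ε = δ y := by rw [hε, map_sub, map_C_eq_zero, sub_zero]
  rw [sexp, ← hε, δ.leibniz, map_C_eq_zero, h1.unique h2, h3]
  simp only [smul_eq_mul]
  ring

end Derivations

end GenSeries

/-! ### Derivations on series over a Hahn group -/

namespace GenSeries

open HahnSeries Function

section HahnGroup

variable {Φ : Type*} [LinearOrder Φ]

theorem coeff_atom (φ χ : Φ) (r : ℝ) [Decidable (χ = φ)] :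
    (ofLex (atom φ r)).coeff χ = if χ = φ then r else 0 := by
  simp [atom, coeff_single]

theorem coeff_atom_of_ne {φ χ : Φ} (h : χ ≠ φ) (r : ℝ) : (ofLex (atom φ r)).coeff χ = 0 :=
  coeff_single_of_ne h

theorem coeff_atom_same (φ : Φ) (r : ℝ) : (ofLex (atom φ r)).coeff φ = r :=
  coeff_single_same _ _

/-- Convexity of the lexicographic order: if `0 ≤ h ≤ k` and `k` vanishes at all indices up to
`ψ`, then so does `h`. -/
theorem coeff_eq_zero_of_nonneg_of_le {h k : HahnGroup Φ} (h0 : 0 ≤ h) (hk : h ≤ k) {ψ : Φ}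
    (hψ : ∀ χ ≤ ψ, (ofLex k).coeff χ = 0) : ∀ χ ≤ ψ, (ofLex h).coeff χ = 0 := by
  obtain rfl | h0 := h0.eq_or_lt
  · intro χ _
    rfl
  obtain ⟨i, hi, hi'⟩ := (HahnSeries.lt_iff _ _).1 h0
  have hψi : ψ < i := by
    by_contra! hle
    refine hk.not_gt ((HahnSeries.lt_iff _ _).2 ⟨i, fun j hj => ?_, ?_⟩)
    · rw [hψ j (hj.le.trans hle), ← hi j hj]
      rfl
    · rw [hψ i hle]
      exact hi'
  exact fun χ hχ => (hi χ (hχ.trans_lt hψi)).symm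

/-- The conditions on `θ` under which `D (t ^ g) = ∑ g_φ t ^ (g + θ φ)` defines a series
derivation with constant field `ℝ`: `θ` is strictly increasing, and for `ψ < φ` the values `θ φ`
and `θ ψ` agree at all indices up to `ψ`. -/
structure IsAdmissible (θ : Φ → HahnGroup Φ) : Prop where
  strictMono : StrictMono θ
  coeff_eq : ∀ ⦃ψ φ⦄, ψ < φ → ∀ χ ≤ ψ, (ofLex (θ φ)).coeff χ = (ofLex (θ ψ)).coeff χ

variable {θ : Φ → HahnGroup Φ}

/-- No sequence of pairs `p n = (g_n, φ_n)`, with `g_n` in a well-ordered set and `φ_n` in the support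
of `g_n`, is a bad sequence for `g + θ φ`. Passing to a subsequence, the `g_n` increase. If the `φ_n`
increase too, so does `g_n + θ φ_n`. If they decrease, then `g_n + θ φ_n ≤ g_0 + θ φ_0` forces `g_n` and `g_0` to agree up to `φ_n`,
so that all the `φ_n` lie in the well-ordered support of `g_0`. -/
theorem IsAdmissible.exists_lt (hθ : IsAdmissible θ) {S : Set (HahnGroup Φ)} (hS : S.IsPWO)
    (p : ℕ → HahnGroup Φ × Φ) (hp : ∀ n, (p n).1 ∈ S)
    (hp' : ∀ n, (p n).2 ∈ (ofLex (p n).1).support) :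
    ∃ i j, i < j ∧ (p i = p j ∨ (p i).1 + θ (p i).2 < (p j).1 + θ (p j).2) := by
  obtain ⟨a, ha⟩ := hS.exists_monotone_subseq hp
  obtain ⟨b, hb | hb⟩ :=
    exists_increasing_or_nonincreasing_subseq (· ≤ ·) fun n => (p (a n)).2
  · refine ⟨a (b 0), a (b 1), by simp, ?_⟩
    have h1 : (p (a (b 0))).1 ≤ (p (a (b 1))).1 := ha (by simp)
    have h2 := hb 0 1 one_pos
    rcases h1.eq_or_lt with h1' | h1'
    · rcases h2.eq_or_lt with h2' | h2'
      · exact Or.inl (Prod.ext h1' h2')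
      · exact Or.inr (add_lt_add_of_le_of_lt h1 (hθ.strictMono h2'))
    · exact Or.inr (add_lt_add_of_lt_of_le h1' (hθ.strictMono.monotone h2))
  · by_contra! hcon
    have hmem : ∀ n, (p (a (b (n + 1)))).2 ∈ (ofLex (p (a (b 0))).1).support := by
      intro n
      have hlt : (p (a (b (n + 1)))).2 < (p (a (b 0))).2 := not_le.1 (hb 0 (n + 1) n.succ_pos)
      have hle : (p (a (b 0))).1 ≤ (p (a (b (n + 1)))).1 := ha (by simp)
      have h := (hcon (a (b 0)) (a (b (n + 1))) (by simp)).2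
      have h0 := coeff_eq_zero_of_nonneg_of_le (sub_nonneg.2 hle)
        (k := θ (p (a (b 0))).2 - θ (p (a (b (n + 1)))).2)
        (sub_le_sub_iff.2 (by rwa [add_comm (θ _)]))
        (fun χ hχ => sub_eq_zero.2 (hθ.coeff_eq hlt χ hχ)) _ le_rfl
      have := hp' (a (b (n + 1)))
      rw [HahnSeries.mem_support] at this ⊢
      exact fun hz => this ((sub_eq_zero.1 h0).trans hz)
    obtain ⟨g, hg⟩ := (ofLex (p (a (b 0))).1).isPWO_support.exists_monotone_subseq hmem
    exact hb (g 0 + 1) (g 1 + 1) (by simp) (hg zero_le_one)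

/-- The pairs `(g, φ)` with `g ∈ S` and `g_φ ≠ 0`; they index the monomials `t ^ (g + θ φ)` in the
derivative of a series with support `S`. -/
def derivPairs (S : Set (HahnGroup Φ)) : Set (HahnGroup Φ × Φ) :=
  {p | p.1 ∈ S ∧ p.2 ∈ (ofLex p.1).support}

theorem IsAdmissible.isPWO_image (hθ : IsAdmissible θ) {S : Set (HahnGroup Φ)} (hS : S.IsPWO) :
    ((fun p : HahnGroup Φ × Φ => p.1 + θ p.2) '' derivPairs S).IsPWO := by
  intro f
  choose p hp hpf using fun n => (f n).2
  obtain ⟨i, j, hij, h⟩ := hθ.exists_lt hS p (fun n => (hp n).1) fun n => (hp n).2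
  refine ⟨i, j, hij, ?_⟩
  change ((f i : HahnGroup Φ)) ≤ f j
  rw [← hpf, ← hpf]
  rcases h with h | h
  · rw [h]
  · exact h.le

theorem IsAdmissible.finite_fiber (hθ : IsAdmissible θ) {S : Set (HahnGroup Φ)} (hS : S.IsPWO)
    (m : HahnGroup Φ) : {p ∈ derivPairs S | p.1 + θ p.2 = m}.Finite := by
  by_contra hinf
  let f := Set.Infinite.natEmbedding _ hinf
  obtain ⟨i, j, hij, h | h⟩ := hθ.exists_lt hS (fun n => (f n : HahnGroup Φ × Φ))
    (fun n => (f n).2.1.1) fun n => (f n).2.1.2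
  · exact hij.ne (f.injective (Subtype.ext h))
  · rw [(f i).2.2, (f j).2.2] at h
    exact lt_irrefl _ h

/-- The family `g_φ t ^ (θ φ)`. -/
noncomputable def IsAdmissible.logDerivFamily (hθ : IsAdmissible θ) (g : HahnGroup Φ) :
    SummableFamily (HahnGroup Φ) ℝ Φ where
  toFun φ := (ofLex g).coeff φ • mono (θ φ)
  isPWO_iUnion_support' := by
    classical
    refine ((ofLex g).isPWO_support.image_of_monotone hθ.strictMono.monotone).mono
      (Set.iUnion_subset fun φ m hm => ⟨φ, fun h => ?_, ?_⟩)
    · simp [h] at hm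
    · by_contra hne
      simp [coeff_mono, Ne.symm hne] at hm
  finite_co_support' m := by
    classical
    refine Set.Subsingleton.finite fun φ hφ ψ hψ => ?_
    have key : ∀ {χ}, ((ofLex g).coeff χ • mono (θ χ)).coeff m ≠ 0 → m = θ χ := fun {χ} h => by
      by_contra hne
      simp [coeff_mono, hne] at h
    exact hθ.strictMono.injective ((key hφ).symm.trans (key hψ))

/-- The logarithmic derivative `∑ g_φ t ^ (θ φ)` of the monomial `t ^ g`. -/
noncomputable def IsAdmissible.logDeriv (hθ : IsAdmissible θ) (g : HahnGroup Φ) :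
    Series (HahnGroup Φ) :=
  (hθ.logDerivFamily g).hsum

theorem IsAdmissible.hasSeriesSum_logDeriv (hθ : IsAdmissible θ) (g : HahnGroup Φ) :
    HasSeriesSum (fun φ => (ofLex g).coeff φ • mono (θ φ)) (hθ.logDeriv g) :=
  ⟨hθ.logDerivFamily g, fun _ => rfl, rfl⟩

theorem IsAdmissible.coeff_logDeriv (hθ : IsAdmissible θ) (g : HahnGroup Φ) (φ : Φ) :
    (hθ.logDeriv g).coeff (θ φ) = (ofLex g).coeff φ := by
  classical
  rw [(hθ.hasSeriesSum_logDeriv g).coeff, finsum_eq_single _ φ fun ψ hψ => ?_]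
  · simp [coeff_mono]
  · simp [coeff_mono, hθ.strictMono.injective.ne hψ.symm]

theorem IsAdmissible.exists_of_coeff_ne_zero (hθ : IsAdmissible θ) {g m : HahnGroup Φ}
    (h : (mono g * hθ.logDeriv g).coeff m ≠ 0) :
    ∃ φ ∈ (ofLex g).support, g + θ φ = m := by
  classical
  rw [mono, coeff_single_mul, one_mul, (hθ.hasSeriesSum_logDeriv g).coeff] at h
  obtain ⟨φ, hφ⟩ : ∃ φ, ((ofLex g).coeff φ • mono (θ φ)).coeff (m - g) ≠ 0 := by
    by_contra! h0
    exact h (finsum_eq_zero_of_forall_eq_zero h0)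
  have hm : m - g = θ φ := by
    by_contra hne
    simp [coeff_mono, hne] at hφ
  refine ⟨φ, fun h0 => ?_, by rw [← hm, add_sub_cancel]⟩
  simp [h0] at hφ

/-- The family `a_g D (t ^ g)`, where `D (t ^ g)` is `t ^ g` times its logarithmic derivative. -/
noncomputable def IsAdmissible.derivFamily (hθ : IsAdmissible θ) (a : Series (HahnGroup Φ)) :
    SummableFamily (HahnGroup Φ) ℝ (HahnGroup Φ) where
  toFun g := a.coeff g • (mono g * hθ.logDeriv g)
  isPWO_iUnion_support' := by
    refine (hθ.isPWO_image a.isPWO_support).mono (Set.iUnion_subset fun g m hm => ?_)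
    rw [HahnSeries.mem_support, HahnSeries.coeff_smul, smul_eq_mul] at hm
    obtain ⟨φ, hφ, rfl⟩ := hθ.exists_of_coeff_ne_zero (right_ne_zero_of_mul hm)
    exact ⟨(g, φ), ⟨left_ne_zero_of_mul hm, hφ⟩, rfl⟩
  finite_co_support' m := by
    refine ((hθ.finite_fiber a.isPWO_support m).image Prod.fst).subset fun g hm => ?_
    rw [Set.mem_ofPred_eq, HahnSeries.coeff_smul, smul_eq_mul] at hm
    obtain ⟨φ, hφ, rfl⟩ := hθ.exists_of_coeff_ne_zero (right_ne_zero_of_mul hm)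
    exact ⟨(g, φ), ⟨⟨left_ne_zero_of_mul hm, hφ⟩, rfl⟩, rfl⟩

/-- The map `a ↦ ∑ a_g D (t ^ g)`. -/
noncomputable def IsAdmissible.deriv (hθ : IsAdmissible θ) (a : Series (HahnGroup Φ)) :
    Series (HahnGroup Φ) :=
  (hθ.derivFamily a).hsum

theorem IsAdmissible.deriv_mono (hθ : IsAdmissible θ) (g : HahnGroup Φ) :
    hθ.deriv (mono g) = mono g * hθ.logDeriv g := by
  classical
  have h1 : HasSeriesSum (fun k => (mono g).coeff k • (mono k * hθ.logDeriv k))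
    (hθ.deriv (mono g)) := ⟨hθ.derivFamily (mono g), fun _ => rfl, rfl⟩
  have h2 := HasSeriesSum.of_single (a := g)
    (f := fun k => (mono g).coeff k • (mono k * hθ.logDeriv k))
    fun k hk => by ext m; simp [coeff_mono, hk]
  rw [h1.unique h2]
  ext m
  rw [HahnSeries.coeff_smul, coeff_mono, if_pos rfl, smul_eq_mul, one_mul]

theorem IsAdmissible.isSeriesDerivation (hθ : IsAdmissible θ) :
    IsSeriesDerivation (OrderAddMonoidHom.id (HahnGroup Φ)) hθ.deriv := by
  refine ⟨fun φ => mono (θ φ), fun g => ⟨_, hθ.hasSeriesSum_logDeriv g, hθ.deriv_mono g⟩,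
    fun a => ?_⟩
  simp only [hθ.deriv_mono]
  exact ⟨hθ.derivFamily a, fun _ => rfl, rfl⟩

theorem logDeriv_atom_eq {D : Series (HahnGroup Φ) → Series (HahnGroup Φ)}
    {L : Φ → Series (HahnGroup Φ)} {φ : Φ} {S : Series (HahnGroup Φ)}
    (hS : HasSeriesSum (fun ψ => (ofLex (atom φ 1)).coeff ψ • L ψ) S)
    (hD : D (mono (atom φ 1)) = mono (atom φ 1) * S) :
    D (mono (atom φ 1)) / mono (atom φ 1) = L φ := by
  classical
  have h := HasSeriesSum.of_single (a := φ)
    (f := fun ψ => (ofLex (atom φ 1)).coeff ψ • L ψ)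
    fun ψ hψ => by ext m; simp [coeff_atom, hψ]
  rw [hD, mul_div_cancel_left₀ _ (mono_ne_zero _), hS.unique h]
  ext m
  rw [HahnSeries.coeff_smul, coeff_atom_same, smul_eq_mul, one_mul]

/-- A series derivation is determined by the logarithmic derivatives of the fundamental
monomials. -/
theorem IsSeriesDerivation.ext {D D' : Series (HahnGroup Φ) → Series (HahnGroup Φ)}
    (hD : IsSeriesDerivation (OrderAddMonoidHom.id (HahnGroup Φ)) D)
    (hD' : IsSeriesDerivation (OrderAddMonoidHom.id (HahnGroup Φ)) D')
    (h : ∀ φ, D (mono (atom φ 1)) / mono (atom φ 1) = D' (mono (atom φ 1)) / mono (atom φ 1)) :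
    D = D' := by
  obtain ⟨L, hL, hs⟩ := hD
  obtain ⟨L', hL', hs'⟩ := hD'
  have hLL : L = L' := by
    funext φ
    obtain ⟨S, hS, hD⟩ := hL (atom φ 1)
    obtain ⟨S', hS', hD'⟩ := hL' (atom φ 1)
    rw [← logDeriv_atom_eq hS hD, ← logDeriv_atom_eq hS' hD', h]
  subst hLL
  have hmono : ∀ g, D (mono g) = D' (mono g) := fun g => by
    obtain ⟨S, hS, hD⟩ := hL g
    obtain ⟨S', hS', hD'⟩ := hL' g
    rw [hD, hD', hS.unique hS']
  funext a
  exact (hs a).unique ((hs' a).congr fun g => by rw [hmono])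

/-- If `g < k`, then no exponent of `D (t ^ k)` is at most `g + θ φ`, provided that no index in the
support of `g` precedes `φ`. -/
theorem IsAdmissible.add_lt_add (hθ : IsAdmissible θ) {g k : HahnGroup Φ} (hgk : g < k) {φ ψ : Φ}
    (hφ' : ∀ χ < φ, (ofLex g).coeff χ = 0)
    (hψ : (ofLex k).coeff ψ ≠ 0) : g + θ φ < k + θ ψ := by
  rcases le_or_gt φ ψ with h | h
  · exact add_lt_add_of_lt_of_le hgk (hθ.strictMono.monotone h)
  · by_contra! hle
    have h0 := coeff_eq_zero_of_nonneg_of_le (sub_nonneg.2 hgk.le) (k := θ φ - θ ψ)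
      (sub_le_sub_iff.2 (by rwa [add_comm (θ φ)]))
      (fun χ hχ => sub_eq_zero.2 (hθ.coeff_eq h χ hχ)) ψ le_rfl
    exact hψ ((sub_eq_zero.1 h0).trans (hφ' ψ h))

/-- With `g` the order of `y` and `φ` the least index in the support of `g`, the exponent `g + θ φ`
has the coefficient `y_g g_φ` in the derivative of `y`. -/
theorem IsAdmissible.deriv_ne_zero (hθ : IsAdmissible θ) {y : Series (HahnGroup Φ)} (hy : y ≠ 0)
    (h0 : y.coeff 0 = 0) : hθ.deriv y ≠ 0 := by
  set g := y.order with hg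
  have hyg : y.coeff g ≠ 0 := coeff_order_eq_zero.not.2 hy
  have hg0 : ofLex g ≠ 0 := by
    intro h
    exact hyg (by rwa [show g = 0 from h])
  set φ := (ofLex g).isWF_support.min (support_nonempty_iff.2 hg0) with hφ
  have hφg : (ofLex g).coeff φ ≠ 0 :=
    (ofLex g).isWF_support.min_mem (support_nonempty_iff.2 hg0)
  have hmin : ∀ χ < φ, (ofLex g).coeff χ = 0 := fun χ hχ => by
    by_contra hne
    exact Set.IsWF.not_lt_min _ _ hne hχ
  have hcoeff : (hθ.deriv y).coeff (g + θ φ) = y.coeff g * (ofLex g).coeff φ := by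
    rw [hθ.isSeriesDerivation.isStronglyLinear.coeff, finsum_eq_single _ g fun k hk => ?_]
    · rw [hθ.deriv_mono, mono, coeff_single_mul, add_sub_cancel_left, hθ.coeff_logDeriv, one_mul]
    · by_contra hne
      have hk' := order_le_of_coeff_ne_zero (left_ne_zero_of_mul hne)
      rw [hθ.deriv_mono] at hne
      obtain ⟨ψ, hψ, h⟩ := hθ.exists_of_coeff_ne_zero (right_ne_zero_of_mul hne)
      exact (hθ.add_lt_add (lt_of_le_of_ne hk' hk.symm) hmin hψ).ne h.symm
  intro h
  rw [h] at hcoeff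
  exact mul_ne_zero hyg hφg hcoeff.symm

theorem IsAdmissible.extendsToSeriesDerivation (hθ : IsAdmissible θ) :
    ExtendsToSeriesDerivation θ := by
  have hD := hθ.isSeriesDerivation
  set δ := hD.isStronglyLinear.toDerivation hD.map_mono_add with hδ
  have hθL : ∀ φ, hθ.deriv (mono (atom φ 1)) / mono (atom φ 1) = mono (θ φ) := fun φ =>
    logDeriv_atom_eq (L := fun φ => mono (θ φ)) (hθ.hasSeriesSum_logDeriv _) (hθ.deriv_mono _)
  refine ⟨δ, hD, hθL, fun g => ?_, fun x => ⟨fun hx => ?_, ?_⟩, fun D' hD' h => ?_⟩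
  · rw [hδ, IsStronglyLinear.toDerivation_apply, hθ.deriv_mono]
    refine ((hθ.hasSeriesSum_logDeriv g).mul_left (mono g)).congr fun φ => ?_
    rw [← mono_mul_mono]
    simp only [← C_mul_eq_smul]
    ring
  · refine ⟨x.coeff 0, ?_⟩
    by_contra hne
    refine hθ.deriv_ne_zero (sub_ne_zero.2 hne) (by simp [C_apply]) ?_
    change δ _ = 0
    rw [map_sub, map_C_eq_zero, hx, sub_zero]
  · rintro ⟨r, rfl⟩
    exact map_C_eq_zero δ r
  · exact hD'.ext hD fun φ => (h φ).trans (hθL φ).symm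

theorem isAdmissible_neg_atom {σ : Φ → Φ} (hσ : StrictMono σ) (hσ' : ∀ φ, φ < σ φ) :
    IsAdmissible fun φ => -atom (σ φ) 1 where
  strictMono φ ψ h := by
    refine neg_lt_neg ((HahnSeries.lt_iff _ _).2 ⟨σ φ, fun χ hχ => ?_, ?_⟩)
    · rw [coeff_atom_of_ne hχ.ne, coeff_atom_of_ne (hχ.trans (hσ h)).ne]
    · rw [coeff_atom_same, coeff_atom_of_ne (hσ h).ne]
      exact one_pos
  coeff_eq ψ φ h χ hχ := by
    change -(ofLex (atom (σ φ) (1 : ℝ))).coeff χ = -(ofLex (atom (σ ψ) (1 : ℝ))).coeff χ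
    rw [coeff_atom_of_ne ((hχ.trans_lt (hσ' ψ)).ne),
      coeff_atom_of_ne ((hχ.trans_lt (h.trans (hσ' φ))).ne)]

theorem isAdmissible_atom_top (f : Φ ↪o ℝ) {m : Φ} (hm : ∀ φ, φ ≤ m) :
    IsAdmissible fun φ => atom m (f φ) where
  strictMono _ _ h := by
    refine (HahnSeries.lt_iff _ _).2 ⟨m, fun χ hχ => ?_, ?_⟩
    · rw [coeff_atom_of_ne hχ.ne, coeff_atom_of_ne hχ.ne]
    · rw [coeff_atom_same, coeff_atom_same]
      exact f.lt_iff_lt.2 h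
  coeff_eq _ φ h _ hχ := by
    have := (hχ.trans_lt (h.trans_le (hm φ))).ne
    simp only [coeff_atom_of_ne this]

theorem lt_rightEnd {w : ℕ → Φ} (hw : StrictMono w) (hcof : ∀ φ, ∃ n, φ ≤ w n) (φ : Φ) :
    φ < rightEnd w φ := by
  obtain ⟨n, hn⟩ := hcof φ
  exact Nat.sInf_mem (s := {n | φ < w (n + 1)}) ⟨n, hn.trans_lt (hw n.lt_succ_self)⟩

theorem rightEnd_mono {w : ℕ → Φ} (hw : StrictMono w) (hcof : ∀ φ, ∃ n, φ ≤ w n) :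
    Monotone (rightEnd w) := fun _ ψ h =>
  hw.monotone (Nat.succ_le_succ (Nat.sInf_le (h.trans_lt (lt_rightEnd hw hcof ψ))))

theorem isAdmissible_atom_rightEnd (f : Φ ↪o ℝ) (hf : ∀ φ, f φ < 0) {w : ℕ → Φ}
    (hw : StrictMono w) (hcof : ∀ φ, ∃ n, φ ≤ w n) :
    IsAdmissible fun φ => atom (rightEnd w φ) (f φ) where
  strictMono φ _ h := by
    have hle := rightEnd_mono hw hcof h.le
    refine (HahnSeries.lt_iff _ _).2 ⟨rightEnd w φ, fun χ hχ => ?_, ?_⟩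
    · rw [coeff_atom_of_ne hχ.ne, coeff_atom_of_ne (hχ.trans_le hle).ne]
    · rw [coeff_atom_same]
      rcases hle.eq_or_lt with h' | h'
      · rw [h', coeff_atom_same]
        exact f.lt_iff_lt.2 h
      · rw [coeff_atom_of_ne h'.ne]
        exact hf φ
  coeff_eq ψ φ h χ hχ := by
    have h1 := lt_rightEnd hw hcof ψ
    have h2 := h1.trans_le (rightEnd_mono hw hcof h.le)
    simp only [coeff_atom_of_ne (hχ.trans_lt h1).ne, coeff_atom_of_ne (hχ.trans_lt h2).ne]

theorem exists_negative_embedding (e : Φ ↪o ℝ) : ∃ f : Φ ↪o ℝ, ∀ φ, f φ < 0 :=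
  ⟨OrderEmbedding.ofStrictMono (fun φ => -Real.exp (-e φ)) fun _ _ h =>
    neg_lt_neg (Real.exp_lt_exp.2 (neg_lt_neg (e.lt_iff_lt.2 h))),
    fun _ => neg_lt_zero.2 (Real.exp_pos _)⟩

/-- Separability of the real line yields a countable cofinal subset. -/
theorem exists_strictMono_cofinal [Nonempty Φ] [NoMaxOrder Φ] (e : Φ ↪o ℝ) :
    ∃ w : ℕ → Φ, StrictMono w ∧ ∀ φ, ∃ n, φ ≤ w n := by
  obtain ⟨c, hc⟩ := TopologicalSpace.exists_dense_seq (Set.range e)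
  choose a ha using fun n => (c n).2
  have hcof : ∀ φ, ∃ n, φ ≤ a n := by
    intro φ
    obtain ⟨ψ, hψ⟩ := exists_gt φ
    obtain ⟨n, hx⟩ := hc.exists_mem_open
      (isOpen_lt (continuous_const (y := e φ)) continuous_subtype_val)
      ⟨⟨e ψ, ψ, rfl⟩, e.lt_iff_lt.2 hψ⟩
    refine ⟨n, (e.lt_iff_lt.1 ?_).le⟩
    rw [ha]
    exact hx
  choose s hs using fun φ : Φ => exists_gt φ
  -- `w (n + 1)` exceeds both `w n` and `a (n + 1)`.
  let w : ℕ → Φ := fun n => Nat.rec (a 0) (fun k x => s (max x (a (k + 1)))) n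
  have hsucc : ∀ n, w (n + 1) = s (max (w n) (a (n + 1))) := fun n => rfl
  refine ⟨w, strictMono_nat_of_lt_succ fun n => ?_, fun φ => ?_⟩
  · rw [hsucc]
    exact (le_max_left _ _).trans_lt (hs _)
  · obtain ⟨n, hn⟩ := hcof φ
    refine ⟨n, hn.trans ?_⟩
    cases n with
    | zero => exact le_rfl
    | succ n =>
      rw [hsucc]
      exact ((le_max_right _ _).trans_lt (hs _)).le

end HahnGroup

end GenSeries

/-! ### Extension of derivations and the Euler derivation -/

namespace Derivation

section Extension

variable {R S T M : Type*} [CommRing R] [CommRing S] [CommRing T] [Algebra R S] [Algebra R T]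
  [Algebra S T] [IsScalarTower R S T] [AddCommGroup M] [Module R M] [Module S M] [Module T M]
  [IsScalarTower R S M] [IsScalarTower R T M] [IsScalarTower S T M]

/-- Derivations extend along formally étale algebras. -/
theorem exists_extension_of_formallyEtale [Algebra.FormallyEtale S T] (d : Derivation R S M) :
    ∃ d' : Derivation R T M, ∀ s, d' (algebraMap S T s) = d s := by
  have hb := KaehlerDifferential.isBaseChange_of_formallyEtale R S T
  refine ⟨(hb.lift d.liftKaehlerDifferential).compDer (KaehlerDifferential.D R T), fun s => ?_⟩
  have := hb.lift_eq d.liftKaehlerDifferential (KaehlerDifferential.D R S s)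
  rw [KaehlerDifferential.map_D] at this
  exact this.trans (d.liftKaehlerDifferential_comp_D s)

end Extension

/-- Derivations of a formally unramified algebra are determined on the base. -/
theorem eq_of_formallyUnramified {R S T M : Type*} [CommRing R] [CommRing S] [CommRing T]
    [Algebra R T] [Algebra S T] [AddCommGroup M] [Module R M] [Module S M] [Module T M]
    [IsScalarTower S T M] [Algebra.FormallyUnramified S T] {d₁ d₂ : Derivation R T M}
    (h : ∀ s, d₁ (algebraMap S T s) = d₂ (algebraMap S T s)) (t : T) : d₁ t = d₂ t := by
  let d : Derivation S T M := Derivation.mk'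
    { toFun := fun t => d₁ t - d₂ t
      map_add' := fun a b => by simp only [map_add]; abel
      map_smul' := fun s a => by
        rw [Algebra.smul_def, d₁.leibniz, d₂.leibniz, h, algebraMap_smul, algebraMap_smul,
          RingHom.id_apply, smul_sub]
        abel }
    fun a b => by
      simp only [LinearMap.coe_mk, AddHom.coe_mk, leibniz, smul_sub]
      abel
  have : d t = 0 := by
    rw [← d.liftKaehlerDifferential_comp_D,
      Subsingleton.elim (KaehlerDifferential.D S T t) 0, map_zero]
  exact sub_eq_zero.1 this

end Derivation

namespace HahnSeries

variable {Γ R : Type*} [AddCommMonoid Γ] [PartialOrder Γ] [IsOrderedCancelAddMonoid Γ] [CommRing R]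

/-- For an additive map `l` from the exponents to the coefficients: the derivation with
`t ^ g ↦ l g • t ^ g`. -/
noncomputable def eulerDerivation (l : Γ →+ R) : Derivation R (HahnSeries Γ R) (HahnSeries Γ R) :=
  Derivation.mk'
    { toFun := fun x => ⟨fun g => l g * x.coeff g,
        x.isPWO_support.mono fun _ hg h => hg (by simp [h])⟩
      map_add' := fun x y => by ext g; simp [mul_add]
      map_smul' := fun r x => by ext g; simp [mul_left_comm] }
    fun x y => by
      set x' : HahnSeries Γ R := ⟨fun g => l g * x.coeff g,
        x.isPWO_support.mono fun _ hg h => hg (by simp [h])⟩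
      set y' : HahnSeries Γ R := ⟨fun g => l g * y.coeff g,
        y.isPWO_support.mono fun _ hg h => hg (by simp [h])⟩
      have hx : x'.support ⊆ x.support := fun _ hg h => hg (by simp [x', h])
      have hy : y'.support ⊆ y.support := fun _ hg h => hg (by simp [y', h])
      ext g
      change l g * (x * y).coeff g = (x * y' + y * x').coeff g
      rw [mul_comm y, coeff_add, coeff_mul, coeff_mul_right' y.isPWO_support hy,
        coeff_mul_left' x.isPWO_support hx, Finset.mul_sum, ← Finset.sum_add_distrib]
      refine Finset.sum_congr rfl fun p hp => ?_
      rw [← (Finset.mem_antidiagonal.1 hp).2.2, map_add]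
      change _ = x.coeff p.1 * (l p.2 * y.coeff p.2) + l p.1 * x.coeff p.1 * y.coeff p.2
      ring

@[simp]
theorem coeff_eulerDerivation (l : Γ →+ R) (x : HahnSeries Γ R) (g : Γ) :
    (eulerDerivation l x).coeff g = l g * x.coeff g := rfl

theorem eulerDerivation_div {Γ R : Type*} [AddCommGroup Γ] [LinearOrder Γ] [IsOrderedAddMonoid Γ]
    [Field R] (l : Γ →+ R) (x y : HahnSeries Γ R) :
    eulerDerivation l (x / y)
      = y⁻¹ ^ 2 * (y * eulerDerivation l x - x * eulerDerivation l y) := by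
  rw [Derivation.leibniz_div]
  simp only [smul_eq_mul]

/-- The logarithmic Euler derivative of a Laurent series has the order as constant coefficient. -/
theorem coeff_zero_eulerDerivation_div {E : Type*} [Field E] {x : HahnSeries ℤ E} (hx : x ≠ 0) :
    (eulerDerivation (Int.castAddHom E) x / x).coeff 0 = x.order := by
  set q := eulerDerivation (Int.castAddHom E) x / x with hq
  have hmul : q * x = eulerDerivation (Int.castAddHom E) x := div_mul_cancel₀ _ hx
  have hxn : x.coeff x.order ≠ 0 := coeff_order_eq_zero.not.2 hx
  have hcoeff : ∀ k, (q * x).coeff k = k * x.coeff k := fun k => by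
    rw [hmul, coeff_eulerDerivation, Int.coe_castAddHom]
  obtain h0 | h0 := eq_or_ne q 0
  · have := hcoeff x.order
    rw [h0, zero_mul, coeff_zero, zero_eq_mul] at this
    rw [h0, coeff_zero, this.resolve_right hxn]
  have hlead : (q * x).coeff (q.order + x.order) = q.coeff q.order * x.coeff x.order := by
    rw [coeff_mul_order_add_order, leadingCoeff_eq, leadingCoeff_eq]
  have hqn : q.coeff q.order ≠ 0 := coeff_order_eq_zero.not.2 h0
  have hpos : 0 ≤ q.order := by
    have hne : (q * x).coeff (q.order + x.order) ≠ 0 := hlead ▸ mul_ne_zero hqn hxn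
    rw [hcoeff] at hne
    have := order_le_of_coeff_ne_zero (right_ne_zero_of_mul hne)
    linarith
  rcases hpos.eq_or_lt with hq0 | hq0
  · rw [← hq0, zero_add, hcoeff] at hlead
    exact (mul_right_cancel₀ hxn hlead).symm
  · have h1 : (q * x).coeff x.order = 0 := by
      refine coeff_eq_zero_of_lt_order ?_
      rw [order_mul h0 hx]
      linarith
    rw [hcoeff] at h1
    rw [coeff_eq_zero_of_lt_order hq0, (mul_eq_zero.1 h1).resolve_right hxn]

end HahnSeries

/-! ### Logarithmic derivatives and residues -/

open scoped Differential in
/-- A relation `∑ e_j w_j′ / w_j = u′` in an algebraic extension descends to the base field: sum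
its conjugates, so that the `w_j` are replaced by their norms and `u` by its trace, taken in a
finite subextension. -/
theorem Differential.exists_logDeriv_relation_of_isAlgebraic {F K : Type*} [Field F] [Field K]
    [CharZero F] [Algebra F K] [Algebra.IsAlgebraic F K] [Differential F] [Differential K]
    [DifferentialAlgebra F K] {ι : Type*} [Fintype ι] (e : ι → F) (w : ι → K)
    (hw : ∀ j, w j ≠ 0) (u : K)
    (h : ∑ j, algebraMap F K (e j) * logDeriv (w j) = u′) :
    ∃ (d : ℕ) (N : ι → F) (T : F), 0 < d ∧ (∀ j, N j ≠ 0) ∧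
      (∀ j f, w j = algebraMap F K f → N j = f ^ d) ∧ ∑ j, e j * logDeriv (N j) = T′ := by
  let M := IntermediateField.adjoin F (Set.range w ∪ {u})
  have hfin : FiniteDimensional F M := IntermediateField.finiteDimensional_adjoin
    fun x _ => Algebra.IsIntegral.isIntegral x
  -- The derivation of `F` extends uniquely to its algebraic closure, so it commutes with the
  -- `F`-embeddings of `K`.
  let Ω := AlgebraicClosure F
  have : Algebra.FormallyEtale F Ω := .of_isSeparable F Ω
  obtain ⟨d', hd'⟩ := ((Algebra.linearMap F Ω).compDer
    (Differential.deriv : Derivation ℤ F F)).exists_extension_of_formallyEtale (T := Ω)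
  let _ : Differential Ω := ⟨d'⟩
  have : DifferentialAlgebra F Ω := ⟨fun a => hd' a⟩
  let w' : ι → M := fun j => ⟨w j, IntermediateField.subset_adjoin _ _ (Or.inl ⟨j, rfl⟩)⟩
  let u' : M := ⟨u, IntermediateField.subset_adjoin _ _ (Or.inr rfl)⟩
  have hw' : ∀ j, w' j ≠ 0 := fun j hj => hw j (congrArg Subtype.val hj)
  have hN : ∀ j, Algebra.norm F (w' j) ≠ 0 := fun j => Algebra.norm_ne_zero_iff.2 (hw' j)
  have hconj : ∀ σ : M →ₐ[F] Ω,
      ∑ j, algebraMap F Ω (e j) * logDeriv (σ (w' j)) = (σ u')′ := by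
    intro σ
    obtain ⟨τ, rfl⟩ := IsAlgClosed.surjective_domRestrict_of_isAlgebraic (E := K) (L := M) σ
    have hτ : ∀ x, τ x′ = (τ x)′ := algHom_deriv' τ τ.injective
    have h1 := congrArg τ h
    rw [map_sum, hτ] at h1
    refine Eq.trans (Finset.sum_congr rfl fun j _ => ?_) h1
    rw [map_mul, AlgHom.commutes, logDeriv, logDeriv, map_div₀, hτ]
    rfl
  refine ⟨Module.finrank F M, fun j => Algebra.norm F (w' j), Algebra.trace F M u',
    Module.finrank_pos, hN, fun j f hf => ?_, ?_⟩
  · rw [← Algebra.norm_algebraMap (S := M)]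
    exact congrArg _ (Subtype.ext hf)
  · apply (algebraMap F Ω).injective
    rw [← deriv_algebraMap, trace_eq_sum_embeddings Ω, map_sum, map_sum]
    have h2 : ∑ σ : M →ₐ[F] Ω, (σ u')′ = ∑ σ : M →ₐ[F] Ω,
        ∑ j, algebraMap F Ω (e j) * logDeriv (σ (w' j)) :=
      Finset.sum_congr rfl fun σ _ => (hconj σ).symm
    rw [h2, Finset.sum_comm]
    refine Finset.sum_congr rfl fun j _ => ?_
    rw [map_mul, ← logDeriv_algebraMap, Algebra.norm_eq_prod_embeddings F Ω, logDeriv_prod,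
      Finset.mul_sum]
    exact fun σ _ => (map_ne_zero σ).2 (hw' j)

namespace HahnSeries

open Polynomial

variable {E : Type*} [Field E]

/-- The expansion of a polynomial as a Laurent series. -/
noncomputable def laurentOfPolynomial (E : Type*) [Field E] : E[X] →+* HahnSeries ℤ E :=
  (HahnSeries.ofPowerSeries ℤ E).comp Polynomial.coeToPowerSeries.ringHom

theorem laurentOfPolynomial_injective : Function.Injective (laurentOfPolynomial E) :=
  HahnSeries.ofPowerSeries_injective.comp (Polynomial.coe_injective E)

theorem laurentOfPolynomial_monomial (n : ℕ) (a : E) :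
    laurentOfPolynomial E (monomial n a) = single (n : ℤ) a := by
  rw [laurentOfPolynomial, RingHom.comp_apply, ← C_mul_X_pow_eq_monomial, map_mul, map_pow,
    Polynomial.coeToPowerSeries.ringHom_apply, Polynomial.coeToPowerSeries.ringHom_apply,
    Polynomial.coe_C, Polynomial.coe_X, map_mul, ofPowerSeries_C, ofPowerSeries_X_pow, C_apply,
    single_mul_single, zero_add, mul_one]

theorem eulerDerivation_laurentOfPolynomial (p : E[X]) :
    eulerDerivation (Int.castAddHom E) (laurentOfPolynomial E p)
      = laurentOfPolynomial E (X * derivative p) := by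
  induction p using Polynomial.induction_on' with
  | add p q hp hq => simp only [map_add, mul_add, hp, hq]
  | monomial n a =>
    have : X * derivative (monomial n a) = monomial n (n * a) := by
      rw [derivative_monomial, X_mul_monomial]
      cases n <;> simp [mul_comm]
    rw [this, laurentOfPolynomial_monomial, laurentOfPolynomial_monomial]
    ext g
    rw [coeff_eulerDerivation]
    by_cases hg : g = n
    · simp [hg]
    · simp [coeff_single_of_ne hg]

end HahnSeries

open scoped Differential Polynomial in
/-- Residues in a rational function field with the derivation `X d/dX`: the logarithmic derivative
of `N` has residue the order of `N` at `0`, and a derivative has residue `0`. -/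
theorem Differential.exists_int_relation_of_isFractionRing {E F : Type*} [Field E] [Field F]
    [Algebra E[X] F] [IsFractionRing E[X] F] [Differential F]
    (hX : ∀ p : E[X], (algebraMap E[X] F p)′
      = algebraMap E[X] F (Polynomial.X * Polynomial.derivative p))
    {ι : Type*} [Fintype ι] (e : ι → E) (N : ι → F) (hN : ∀ j, N j ≠ 0) (T : F)
    (h : ∑ j, algebraMap E[X] F (Polynomial.C (e j)) * logDeriv (N j) = T′) :
    ∃ n : ι → ℤ, ∑ j, e j * n j = 0 ∧
      ∀ j (d : ℕ), N j = algebraMap E[X] F Polynomial.X ^ d → n j = d := by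
  let φ : F →+* HahnSeries ℤ E :=
    IsFractionRing.lift HahnSeries.laurentOfPolynomial_injective
  let δ := HahnSeries.eulerDerivation (Int.castAddHom E)
  have hφp : ∀ p, φ (algebraMap E[X] F p) = HahnSeries.laurentOfPolynomial E p :=
    IsFractionRing.lift_algebraMap _
  have hφ : ∀ f, φ f′ = δ (φ f) := by
    intro f
    obtain ⟨p, q, -, rfl⟩ := IsFractionRing.div_surjective E[X] f
    rw [Derivation.leibniz_div, map_div₀ φ, HahnSeries.eulerDerivation_div, hX, hX]
    simp only [smul_eq_mul, map_mul, map_sub, map_pow, map_inv₀, hφp,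
      HahnSeries.eulerDerivation_laurentOfPolynomial]
  have hN' : ∀ j, φ (N j) ≠ 0 := fun j => (map_ne_zero φ).2 (hN j)
  refine ⟨fun j => (φ (N j)).order, ?_, fun j d hj => ?_⟩
  · have h1 := congrArg (fun x => HahnSeries.coeff x 0) (congrArg φ h)
    simp only [map_sum, map_mul, hφp, hφ, HahnSeries.coeff_sum, logDeriv, map_div₀] at h1
    have hC : ∀ a : E, HahnSeries.laurentOfPolynomial E (Polynomial.C a) = HahnSeries.C a :=
      fun a => HahnSeries.laurentOfPolynomial_monomial 0 a
    simpa only [hC, HahnSeries.C_mul_eq_smul, HahnSeries.coeff_smul, smul_eq_mul, δ,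
      HahnSeries.coeff_zero_eulerDerivation_div (hN' _), HahnSeries.coeff_eulerDerivation,
      map_zero, zero_mul] using h1
  · have : φ (N j) = HahnSeries.single (d : ℤ) 1 := by
      rw [hj, ← map_pow, hφp, Polynomial.X_pow_eq_monomial,
        HahnSeries.laurentOfPolynomial_monomial]
    change (φ (N j)).order = d
    rw [this, HahnSeries.order_single one_ne_zero]

open scoped Polynomial Differential in
/-- If `K` is algebraic over the field `F` of rational functions in `X` over `E`, and
`∑ e_j d w_j / w_j` is exact in `Ω_{K/E}` (here: after evaluation at all derivations), where `X` is
one of the `w_j`, then the `e_j` satisfy a nontrivial integral relation: take residues at `0`. -/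
theorem exists_int_relation_of_isFractionRing {E F K : Type*} [Field E] [CharZero E] [Field F]
    [Field K] [Algebra E F] [Algebra E K] [Algebra E[X] F] [Algebra E[X] K] [Algebra F K]
    [IsScalarTower E E[X] F] [IsScalarTower E E[X] K] [IsScalarTower E F K]
    [IsScalarTower E[X] F K] [IsFractionRing E[X] F] [Algebra.IsAlgebraic F K] {ι : Type*}
    [Fintype ι] (e : ι → E) (w : ι → K) (hw : ∀ j, w j ≠ 0) (u : K) {j₀ : ι}
    (hj₀ : w j₀ = algebraMap E[X] K Polynomial.X)
    (h : ∀ δ : Derivation E K K, ∑ j, algebraMap E K (e j) * (δ (w j) / w j) = δ u) :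
    ∃ n : ι → ℤ, n j₀ ≠ 0 ∧ ∑ j, e j * n j = 0 := by
  have : CharZero F := charZero_of_injective_algebraMap (algebraMap E F).injective
  have : Algebra.FormallyEtale F K := .of_isSeparable F K
  have : Algebra.FormallyEtale E[X] F := .of_isLocalization (nonZeroDivisors E[X])
  -- Among the derivations of `K` is the extension of `X d/dX`.
  let d : Derivation E E[X] E[X] := (Polynomial.X : E[X]) • Polynomial.derivative'
  obtain ⟨dF, hdF⟩ :=
    ((Algebra.linearMap E[X] F).compDer d).exists_extension_of_formallyEtale (T := F)
  obtain ⟨dK, hdK⟩ := ((Algebra.linearMap F K).compDer dF).exists_extension_of_formallyEtale (T := K)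
  let _ : Differential F := ⟨dF.restrictScalars ℤ⟩
  let _ : Differential K := ⟨dK.restrictScalars ℤ⟩
  have : DifferentialAlgebra F K := ⟨hdK⟩
  have hE : ∀ a : E, algebraMap F K (algebraMap E[X] F (Polynomial.C a)) = algebraMap E K a :=
    fun a => by
      rw [← IsScalarTower.algebraMap_apply E[X] F K, ← Polynomial.algebraMap_eq,
        ← IsScalarTower.algebraMap_apply E E[X] K]
  have h' : ∑ j, algebraMap F K (algebraMap E[X] F (Polynomial.C (e j))) *
      Differential.logDeriv (w j) = u′ := by
    simp only [hE]
    exact h dK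
  obtain ⟨k, N, T, hk, hN, hNf, hrel⟩ :=
    Differential.exists_logDeriv_relation_of_isAlgebraic _ w hw u h'
  obtain ⟨n, hn, hnX⟩ := Differential.exists_int_relation_of_isFractionRing
    (fun p => hdF p) e N hN T hrel
  refine ⟨n, ?_, hn⟩
  rw [hnX j₀ k (hNf j₀ _ ?_)]
  · exact_mod_cast hk.ne'
  · rw [hj₀, ← IsScalarTower.algebraMap_apply E[X] F K]

open scoped Polynomial in
/-- If `K` is algebraic over `E[s]`, with `s` transcendental over `E`, and `∑ e_j d w_j / w_j` is exact
in `Ω_{K/E}` (here: after evaluation at all derivations), where `s` is one of the `w_j`, then the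
`e_j` satisfy a nontrivial integral relation. -/
theorem exists_int_relation_of_logDeriv_exact {E K : Type*} [Field E] [CharZero E] [Field K]
    [Algebra E K] {s : K} (hs : Transcendental E s)
    (halg : Algebra.IsAlgebraic (Algebra.adjoin E {s}) K) {ι : Type*} [Fintype ι] (e : ι → E)
    (w : ι → K) (hw : ∀ j, w j ≠ 0) (u : K) {j₀ : ι} (hj₀ : w j₀ = s)
    (h : ∀ δ : Derivation E K K, ∑ j, algebraMap E K (e j) * (δ (w j) / w j) = δ u) :
    ∃ n : ι → ℤ, n j₀ ≠ 0 ∧ ∑ j, e j * n j = 0 := by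
  let _ : Algebra E[X] K := (Polynomial.aeval s).toAlgebra
  have hmap : ∀ p : E[X], algebraMap E[X] K p = Polynomial.aeval s p := fun _ => rfl
  have : FaithfulSMul E[X] K :=
    (faithfulSMul_iff_algebraMap_injective _ _).2 (transcendental_iff_injective.1 hs)
  have : IsScalarTower E E[X] K := .of_algebraMap_eq fun a => by simp [hmap]
  let F := FractionRing E[X]
  let _ : Algebra F K := FractionRing.liftAlgebra E[X] K
  have : IsScalarTower E[X] F K := FractionRing.isScalarTower_liftAlgebra E[X] K
  have : IsScalarTower E F K := .of_algebraMap_eq fun a => by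
    rw [IsScalarTower.algebraMap_apply E E[X] F, ← IsScalarTower.algebraMap_apply E[X] F K,
      ← IsScalarTower.algebraMap_apply E E[X] K]
  have : Algebra.IsAlgebraic E[X] K := by
    let f : E[X] →+* Algebra.adjoin E {s} :=
      ((Polynomial.aeval s).codRestrict _ fun p => Polynomial.aeval_mem_adjoin_singleton E s)
    refine Algebra.IsAlgebraic.of_ringHom_of_comp_eq f (RingHom.id K) ?_
      Function.injective_id rfl
    rintro ⟨x, hx⟩
    obtain ⟨p, rfl⟩ := Algebra.adjoin_singleton_eq_range_aeval E s ▸ hx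
    exact ⟨p, rfl⟩
  have : Algebra.IsAlgebraic F K := .extendScalars (FaithfulSMul.algebraMap_injective E[X] F)
  exact exists_int_relation_of_isFractionRing (F := F) e w hw u
    (by rw [hj₀, hmap, Polynomial.aeval_X]) h

theorem Subalgebra.isAlgebraic_of_le {C E K : Type*} [Field C] [Field E] [Field K]
    [Algebra C K] [Algebra E K] (A : Subalgebra C K) (B : Subalgebra E K)
    (h : ∀ x ∈ A, x ∈ B) [hA : Algebra.IsAlgebraic A K] : Algebra.IsAlgebraic B K := by
  let f : A →+* B :=
    { toFun := fun x => ⟨x, h x x.2⟩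
      map_one' := rfl
      map_mul' := fun _ _ => rfl
      map_zero' := rfl
      map_add' := fun _ _ => rfl }
  have hf : Function.Injective f := fun x y hxy => by
    exact Subtype.ext (show (f x : K) = f y by rw [hxy])
  refine Algebra.IsAlgebraic.ringHom_of_comp_eq f (RingHom.id K) hf
    Function.surjective_id ?_
  ext x
  rfl

theorem isAlgebraic_adjoin_singleton_of_subset {C E K : Type*} [Field C] [Field E] [Field K]
    [Algebra C E] [Algebra C K] [Algebra E K] [IsScalarTower C E K] {s : K} {t : Set K}
    (h : ∀ x ∈ t, x ∈ Set.range (algebraMap E K) ∨ x = s)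
    [Algebra.IsAlgebraic (Algebra.adjoin C t) K] :
    Algebra.IsAlgebraic (Algebra.adjoin E {s}) K := by
  have hle : ∀ x ∈ Algebra.adjoin C t, x ∈ Algebra.adjoin E {s} := by
    intro x hx
    induction hx using Algebra.adjoin_induction with
    | mem x hx =>
      rcases h x hx with ⟨y, rfl⟩ | rfl
      · exact (Algebra.adjoin E {s}).algebraMap_mem y
      · exact Algebra.subset_adjoin rfl
    | algebraMap c =>
      rw [IsScalarTower.algebraMap_apply C E K]
      exact (Algebra.adjoin E {s}).algebraMap_mem (algebraMap C E c)
    | add x y _ _ hx hy => exact add_mem hx hy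
    | mul x y _ _ hx hy => exact mul_mem hx hy
  exact Subalgebra.isAlgebraic_of_le _ _ hle

/-- A transcendental element `s` of `K` over `C` is a transcendence basis of `K` over some field
`E ⊇ C`. -/
theorem exists_intermediateField_transcendental {C K : Type*} [Field C] [Field K] [Algebra C K]
    {s : K} (hs : Transcendental C s) :
    ∃ E : IntermediateField C K, Transcendental E s ∧
      Algebra.IsAlgebraic (Algebra.adjoin E {s}) K := by
  obtain ⟨t, hst, ht⟩ := exists_isTranscendenceBasis_superset (s := {s})
    ((algebraicIndependent_singleton_iff ⟨s, rfl⟩).2 hs)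
  have hs' : s ∈ t := hst rfl
  refine ⟨IntermediateField.adjoin C (t \ {s}), ?_, ?_⟩
  · rw [IntermediateField.transcendental_adjoin_iff]
    have himg : ((↑) : t → K) '' {x | (x : K) ≠ s} = t \ {s} := by
      ext x
      simp [and_comm]
    have := ht.1.transcendental_adjoin (s := {x | (x : K) ≠ s}) (i := ⟨s, hs'⟩) (by simp)
    rwa [himg] at this
  · have := ht.isAlgebraic
    refine isAlgebraic_adjoin_singleton_of_subset (C := C) (t := Set.range ((↑) : t → K)) ?_
    rintro _ ⟨x, rfl⟩
    exact (em (x.1 = s)).symm.imp_left fun h =>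
      ⟨⟨x, IntermediateField.subset_adjoin C _ ⟨x.2, h⟩⟩, rfl⟩

/-! ### A differential form of the theorem of Ax -/

namespace Derivation

section Constants

variable {k K : Type*} [Field k] [Field K] [Algebra k K]

/-- The field of constants of a derivation. -/
def constants (D : Derivation k K K) : IntermediateField k K where
  carrier := {x | D x = 0}
  mul_mem' {a b} ha hb := by
    change D (a * b) = 0
    rw [D.leibniz, show D a = 0 from ha, show D b = 0 from hb, smul_zero, smul_zero, add_zero]
  add_mem' {a b} ha hb := by
    change D (a + b) = 0
    rw [map_add, show D a = 0 from ha, show D b = 0 from hb, add_zero]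
  algebraMap_mem' r := D.map_algebraMap r
  inv_mem' a ha := by
    change D a⁻¹ = 0
    rw [D.leibniz_inv, show D a = 0 from ha, smul_zero]

/-- In characteristic zero, elements that are algebraic over the constants are constants. -/
theorem transcendental_of_apply_ne_zero [CharZero K] {D : Derivation k K K} {s : K}
    (hs : D s ≠ 0) : Transcendental D.constants s := by
  intro halg
  let D' : Derivation D.constants K K := Derivation.mk'
    { toFun := D
      map_add' := D.map_add
      map_smul' := fun a x => by
        have ha : D (a : K) = 0 := a.2
        change D ((a : K) * x) = (a : K) * D x
        rw [D.leibniz, ha, smul_zero, add_zero, smul_eq_mul] }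
    D.leibniz
  have hsep : (minpoly D.constants s).Separable :=
    (minpoly.irreducible halg.isIntegral).separable
  have h := D'.map_aeval (minpoly D.constants s) s
  rw [minpoly.aeval, map_zero] at h
  exact (mul_ne_zero (hsep.aeval_derivative_ne_zero (minpoly.aeval _ s)) hs) h.symm

/-- The logarithmic derivative `u ↦ D u / u` as a homomorphism. -/
def logDerivHom (D : Derivation k K K) : Kˣ →* Multiplicative K where
  toFun u := Multiplicative.ofAdd (D u / u)
  map_one' := by simp
  map_mul' u v := by
    rw [← ofAdd_add]
    congr 1
    rw [Units.val_mul, D.leibniz]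
    have := u.ne_zero
    have := v.ne_zero
    simp only [smul_eq_mul]
    field_simp
    ring

theorem logDeriv_prod_zpow (D : Derivation k K K) {ι : Type*} (s : Finset ι) (z : ι → K)
    (hz : ∀ i, z i ≠ 0) (m : ι → ℤ) :
    D (∏ i ∈ s, z i ^ m i) / ∏ i ∈ s, z i ^ m i = ∑ i ∈ s, m i * (D (z i) / z i) := by
  have h := map_prod D.logDerivHom (fun i => Units.mk0 (z i) (hz i) ^ m i) s
  simp only [map_zpow] at h
  have h' := congrArg Multiplicative.toAdd h
  simp only [toAdd_prod, toAdd_zpow, zsmul_eq_mul] at h'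
  have hval : ((∏ i ∈ s, Units.mk0 (z i) (hz i) ^ m i : Kˣ) : K) = ∏ i ∈ s, z i ^ m i := by
    simp [Units.coe_prod]
  rw [← hval]
  exact h'

/-- A nonzero space of vectors over `K` that is stable under a derivation contains a nonzero vector
of constants: take a vector of minimal support with an entry equal to `1`. -/
theorem exists_constant_vector (D : Derivation k K K) {ι : Type*} [Fintype ι]
    {P : Submodule K (ι → K)} (hP : P ≠ ⊥) (hD : ∀ f ∈ P, (fun i => D (f i)) ∈ P) :
    ∃ c ∈ P, c ≠ 0 ∧ ∀ i, D (c i) = 0 := by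
  classical
  obtain ⟨f, ⟨hfP, hf0⟩, hmin⟩ := WellFounded.has_min
    (InvImage.wf (fun f : ι → K => (Finset.univ.filter fun i => f i ≠ 0).card) wellFounded_lt)
    {f | f ∈ P ∧ f ≠ 0} ((Submodule.ne_bot_iff P).1 hP)
  obtain ⟨i₀, hi₀⟩ := Function.ne_iff.1 hf0
  let c : ι → K := (f i₀)⁻¹ • f
  have hcP : c ∈ P := P.smul_mem _ hfP
  have hc1 : c i₀ = 1 := inv_mul_cancel₀ hi₀
  have hcf : ∀ i, f i = 0 → c i = 0 := fun i hi => by simp [c, hi]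
  refine ⟨c, hcP, fun h => ?_, fun i => ?_⟩
  · simp [h] at hc1
  · by_contra hne
    refine hmin _ ⟨hD c hcP, fun h => hne (congrFun h i)⟩ (Finset.card_lt_card ?_)
    refine (Finset.ssubset_iff_of_subset fun j hj => ?_).2 ⟨i₀, by simpa using hi₀, by simp [hc1]⟩
    simp only [Finset.mem_filter, Finset.mem_univ, true_and] at hj ⊢
    exact fun h => hj (by rw [hcf j h, map_zero])

/-- A derivation that vanishes on a transcendence basis of an intermediate field vanishes on that
field. -/
theorem eq_zero_of_isTranscendenceBasis [CharZero k] (D : Derivation k K K)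
    {L : IntermediateField k K} {κ : Type*} {x : κ → L} (hx : IsTranscendenceBasis k x)
    (h : ∀ i, D (x i) = 0) (l : L) : D l = 0 := by
  have := hx.isAlgebraic_field
  have : CharZero L := charZero_of_injective_algebraMap (algebraMap k L).injective
  have hmem : ∀ s : IntermediateField.adjoin k (Set.range x), D ((s : L) : K) = 0 := by
    have hle : IntermediateField.adjoin k (Set.range x) ≤ D.constants.comap L.val :=
      IntermediateField.adjoin_le_iff.2 (by rintro _ ⟨i, rfl⟩; exact h i)
    exact fun s => hle s.2
  have : Algebra.FormallyUnramified (IntermediateField.adjoin k (Set.range x)) L :=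
    .of_isSeparable _ L
  exact eq_of_formallyUnramified (S := IntermediateField.adjoin k (Set.range x))
    (d₁ := D.compAlgebraMap L) (d₂ := 0) (fun s => hmem s) l

end Constants

end Derivation

/-- If `ω` factors through `ev`, and `ω` kills a vector
that `ev` does not kill, then the rank of `ω` is smaller than the dimension of the target of `ev`,
and there is a linear relation between the components of `ω`. -/
theorem LinearMap.exists_relation_of_ker_le {K V ι κ : Type*} [Field K] [AddCommGroup V]
    [Module K V] [Fintype ι] [Fintype κ] (hcard : Fintype.card κ ≤ Fintype.card ι)
    (ω : V →ₗ[K] ι → K) (ev : V →ₗ[K] κ → K) (hker : ker ev ≤ ker ω) {v₀ : V} (h₀ : ω v₀ = 0)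
    (h₀' : ev v₀ ≠ 0) : ∃ f : ι → K, f ≠ 0 ∧ ∀ v, ∑ i, f i * ω v i = 0 := by
  classical
  have hrange : range ω < ⊤ := by
    rw [lt_top_iff_ne_top]
    intro htop
    obtain ⟨g, hg⟩ := ω.exists_rightInverse_of_surjective htop
    let F : K × (ι → K) →ₗ[K] κ → K :=
      (ev ∘ₗ (LinearMap.toSpanSingleton K V v₀)).coprod (ev ∘ₗ g)
    have hF : Function.Injective F := by
      rw [← ker_eq_bot, ker_eq_bot']
      rintro ⟨a, v⟩ hav
      have h1 : ev (a • v₀ + g v) = 0 := by simpa [F] using hav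
      have h2 : ω (a • v₀ + g v) = 0 := hker h1
      have h3 : v = 0 := by
        rw [map_add, map_smul, h₀, smul_zero, zero_add] at h2
        rw [← h2]
        exact (LinearMap.congr_fun hg v).symm
      subst h3
      have h4 : a = 0 := by
        rw [map_zero, add_zero, map_smul, smul_eq_zero] at h1
        exact h1.resolve_right h₀'
      rw [h4]
      rfl
    have := LinearMap.finrank_le_finrank_of_injective hF
    simp only [Module.finrank_prod, Module.finrank_self, Module.finrank_fintype_fun_eq_card] at this
    omega
  obtain ⟨f, hf, hle⟩ := Submodule.exists_le_ker_of_lt_top _ hrange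
  refine ⟨fun i => f (Pi.single i 1), fun h => hf ?_, fun v => ?_⟩
  · refine LinearMap.pi_ext' fun i => LinearMap.ext_ring ?_
    simpa using congrFun h i
  · have h1 : f (ω v) = 0 := hle ⟨v, rfl⟩
    rw [LinearMap.pi_apply_eq_sum_univ f] at h1
    rw [← h1]
    refine Finset.sum_congr rfl fun i _ => ?_
    have hi : (fun j => if i = j then 1 else 0) = Pi.single i (1 : K) := by
      ext j
      simp [Pi.single_apply, eq_comm]
    rw [hi, smul_eq_mul, mul_comm]

namespace Derivation

section Ax

variable {k K : Type*} [Field k] [Field K] [Algebra k K] {ι : Type*}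

/-- Evaluation of the differential forms `d z_i / z_i - d y_i` at derivations. -/
noncomputable def evalLogForms (y z : ι → K) : Derivation k K K →ₗ[K] ι → K where
  toFun δ i := δ (z i) / z i - δ (y i)
  map_add' δ δ' := by
    ext i
    simp only [add_apply, Pi.add_apply]
    ring
  map_smul' a δ := by
    ext i
    simp only [smul_apply, Pi.smul_apply, smul_eq_mul, RingHom.id_apply]
    ring

theorem evalLogForms_apply (y z : ι → K) (δ : Derivation k K K) (i : ι) :
    evalLogForms y z δ i = δ (z i) / z i - δ (y i) := rfl

/-- If `D z_i = z_i D y_i`, then the Lie derivative along `D` of `d z_i / z_i - d y_i` vanishes. -/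
theorem apply_evalLogForms {D : Derivation k K K} {y z : ι → K} (hz : ∀ i, z i ≠ 0)
    (h : ∀ i, D (z i) = z i * D (y i)) (δ : Derivation k K K) (i : ι) :
    D (evalLogForms y z δ i) = evalLogForms y z ⁅D, δ⁆ i := by
  have hzi := hz i
  rw [evalLogForms_apply, evalLogForms_apply, commutator_apply, commutator_apply, map_sub,
    leibniz_div, h, δ.leibniz]
  simp only [smul_eq_mul]
  field_simp
  ring

/-- There is no nontrivial relation with constant coefficients between the forms
`d z_i / z_i - d y_i`. Write the coefficients in terms of a `ℤ`-basis `e_j` of the group they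
generate; then `∑ e_j d w_j / w_j` is exact, with `w_j` monomials in the `z_i`. One of the `w_j` is
not constant, hence transcendental over the constants, which is impossible by residues. -/
theorem eq_zero_of_constant_relation [CharZero K] [Fintype ι] {D : Derivation k K K} {y z : ι → K}
    (hz : ∀ i, z i ≠ 0) (h : ∀ i, D (z i) = z i * D (y i))
    (hind : ∀ m : ι → ℤ, ∑ i, m i * D (y i) = 0 → m = 0) {c : ι → K} (hc : ∀ i, D (c i) = 0)
    (hrel : ∀ δ : Derivation k K K, ∑ i, c i * evalLogForms y z δ i = 0) : c = 0 := by
  by_contra hc0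
  obtain ⟨i₀, hi₀⟩ := Function.ne_iff.1 hc0
  let S : Submodule ℤ K := Submodule.span ℤ (Set.range c)
  have : Module.Finite ℤ S := Module.Finite.span_of_finite ℤ (Set.finite_range c)
  let b := Module.Free.chooseBasis ℤ S
  let cS : ι → S := fun i => ⟨c i, Submodule.subset_span ⟨i, rfl⟩⟩
  let m : ι → Module.Free.ChooseBasisIndex ℤ S → ℤ := fun i j => b.repr (cS i) j
  have hcm : ∀ i, c i = ∑ j, m i j * (b j : K) := fun i => by
    have := congrArg (fun x : S => (x : K)) (b.sum_repr (cS i))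
    simp only [Submodule.coe_sum, Submodule.coe_smul, zsmul_eq_mul] at this
    exact this.symm
  have hb : ∀ j, D (b j : K) = 0 := fun j => by
    have hle : S ≤ D.constants.toSubring.toAddSubgroup.toIntSubmodule :=
      Submodule.span_le.2 (by rintro _ ⟨i, rfl⟩; exact hc i)
    exact hle (b j).2
  obtain ⟨j₀, hj₀⟩ : ∃ j, m i₀ j ≠ 0 := by
    by_contra! hm
    exact hi₀ (by rw [hcm]; simp [hm])
  let w : Module.Free.ChooseBasisIndex ℤ S → K := fun j => ∏ i, z i ^ m i j
  have hw : ∀ j, w j ≠ 0 := fun j => Finset.prod_ne_zero_iff.2 fun i _ => zpow_ne_zero _ (hz i)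
  have hDs : D (w j₀) ≠ 0 := by
    intro h0
    have h1 := D.logDeriv_prod_zpow Finset.univ z hz fun i => m i j₀
    rw [show D (∏ i, z i ^ m i j₀) = 0 from h0, zero_div] at h1
    refine hj₀ (congrFun (hind (fun i => m i j₀) ?_) i₀)
    rw [h1]
    refine Finset.sum_congr rfl fun i _ => ?_
    rw [h, mul_div_cancel_left₀ _ (hz i)]
  obtain ⟨E, hE, halg⟩ :=
    exists_intermediateField_transcendental (D.transcendental_of_apply_ne_zero hDs)
  have hCE : ∀ x : K, D x = 0 → x ∈ E := fun x hx => E.algebraMap_mem (⟨x, hx⟩ : D.constants)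
  have : CharZero E :=
    ⟨fun a b hab => Nat.cast_injective (R := K) (by simpa using congrArg (algebraMap E K) hab)⟩
  have hex : ∀ δ : Derivation E K K,
      ∑ j, algebraMap E K ⟨b j, hCE _ (hb j)⟩ * (δ (w j) / w j) = δ (∑ i, c i * y i) := by
    intro δ
    have hδ : ∀ x : K, D x = 0 → δ x = 0 := fun x hx => δ.map_algebraMap ⟨x, hCE x hx⟩
    -- A derivation over `E` kills the constants of `D`, among them `k`; so `hrel` applies to it.
    let δ' : Derivation k K K := Derivation.mk'
      { toFun := δ
        map_add' := δ.map_add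
        map_smul' := fun a x => by
          rw [Algebra.smul_def, δ.leibniz, hδ _ (D.map_algebraMap a), smul_zero, add_zero,
            RingHom.id_apply, smul_eq_mul, Algebra.smul_def] }
      δ.leibniz
    have h1 := hrel δ'
    simp only [evalLogForms_apply, mul_sub, Finset.sum_sub_distrib] at h1
    have h2 : δ (∑ i, c i * y i) = ∑ i, c i * δ (y i) := by
      rw [map_sum]
      refine Finset.sum_congr rfl fun i _ => ?_
      rw [δ.leibniz, hδ _ (hc i), smul_zero, add_zero, smul_eq_mul]
    rw [h2]
    refine Eq.trans ?_ (sub_eq_zero.1 h1)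
    change ∑ j, (b j : K) * (δ' (w j) / w j) = _
    simp only [w, logDeriv_prod_zpow _ _ _ hz, Finset.mul_sum]
    rw [Finset.sum_comm]
    refine Finset.sum_congr rfl fun i _ => ?_
    rw [hcm i, Finset.sum_mul]
    refine Finset.sum_congr rfl fun j _ => ?_
    ring
  obtain ⟨n, hn, hsum⟩ := exists_int_relation_of_logDeriv_exact hE halg
    (fun j => (⟨b j, hCE _ (hb j)⟩ : E)) w hw _ rfl hex
  have hsum' : ∑ j, n j • b j = 0 := by
    apply Subtype.ext
    have := congrArg (fun x : E => (x : K)) hsum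
    simpa [zsmul_eq_mul, mul_comm] using this
  exact hn (Fintype.linearIndependent_iff.1 b.linearIndependent n hsum' j₀)

/-- **Ax's theorem** for one derivation: if `D z_i = z_i D y_i` and the `D y_i` are linearly
independent over `ℤ`, then a field containing the `n ≥ 1` pairs `y_i, z_i` has transcendence degree
at least `n + 1`. -/
theorem card_add_one_le_trdeg [CharZero k] [Fintype ι] [Nonempty ι] (D : Derivation k K K)
    {y z : ι → K} (hz : ∀ i, z i ≠ 0) (h : ∀ i, D (z i) = z i * D (y i))
    (hind : ∀ m : ι → ℤ, ∑ i, m i * D (y i) = 0 → m = 0) (L : IntermediateField k K)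
    (hy : ∀ i, y i ∈ L) (hzL : ∀ i, z i ∈ L) :
    ((Fintype.card ι + 1 : ℕ) : Cardinal) ≤ Algebra.trdeg k L := by
  classical
  have : CharZero K := charZero_of_injective_algebraMap (algebraMap k K).injective
  by_contra! hlt
  obtain ⟨κ, x, hx⟩ := exists_isTranscendenceBasis' k L
  rw [← hx.cardinalMk_eq_trdeg] at hlt
  have : Finite κ := Cardinal.lt_aleph0_iff_finite.1 (hlt.trans (Cardinal.natCast_lt_aleph0))
  have := Fintype.ofFinite κ
  have hcard : Fintype.card κ ≤ Fintype.card ι := by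
    rw [Cardinal.mk_fintype, Nat.cast_lt] at hlt
    omega
  -- Evaluation at a transcendence basis determines the restriction of a derivation to `L`.
  let ev : Derivation k K K →ₗ[K] κ → K :=
    { toFun := fun δ i => δ (x i)
      map_add' := fun _ _ => rfl
      map_smul' := fun _ _ => rfl }
  have hev : ∀ δ : Derivation k K K, ev δ = 0 → ∀ l : L, δ l = 0 := fun δ hδ =>
    δ.eq_zero_of_isTranscendenceBasis hx (congrFun hδ)
  obtain ⟨f, hf, hrel⟩ := LinearMap.exists_relation_of_ker_le hcard (evalLogForms y z) ev
    (fun δ hδ => by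
      ext i
      have := hev δ hδ
      rw [evalLogForms_apply, this ⟨z i, hzL i⟩, this ⟨y i, hy i⟩]
      simp)
    (v₀ := D)
    (by
      ext i
      rw [evalLogForms_apply, h, mul_div_cancel_left₀ _ (hz i), sub_self]
      rfl)
    (fun h0 => by
      obtain ⟨i⟩ := ‹Nonempty ι›
      have h1 := hind (Pi.single i 1) (by
        rw [Finset.sum_eq_single i (fun j _ hj => by simp [hj]) (by simp),
          hev D h0 ⟨y i, hy i⟩, mul_zero])
      simpa using congrFun h1 i)
  -- The relations between the forms; they are stable under `D` by `apply_evalLogForms`.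
  let P : Submodule K (ι → K) :=
    { carrier := {f | ∀ δ : Derivation k K K, ∑ i, f i * evalLogForms y z δ i = 0}
      add_mem' := fun {f g} hf hg δ => by
        simp only [Pi.add_apply, add_mul, Finset.sum_add_distrib, hf δ, hg δ, add_zero]
      zero_mem' := fun δ => by simp
      smul_mem' := fun a f hf δ => by
        simp only [Pi.smul_apply, smul_eq_mul, mul_assoc, ← Finset.mul_sum, hf δ, mul_zero] }
  obtain ⟨c, hcP, hc0, hcD⟩ := D.exists_constant_vector (P := P)
    ((Submodule.ne_bot_iff P).2 ⟨f, hrel, hf⟩) fun g hg δ => by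
      have h1 := congrArg D (hg δ)
      simp only [map_sum, D.leibniz, apply_evalLogForms hz h, smul_eq_mul,
        Finset.sum_add_distrib, hg ⁅D, δ⁆, zero_add, map_zero] at h1
      rw [← h1]
      exact Finset.sum_congr rfl fun i _ => mul_comm _ _
  exact hc0 (eq_zero_of_constant_relation hz h hind hcD hcP)

end Ax

end Derivation

/-! ### Transcendence of exponentials of series -/

/-- Countably many nonzero elements of a torsion-free abelian group are all nonzero under a suitable
homomorphism to the reals: the vector space they span over `ℚ` has countable dimension, so it embeds
in `ℝ`. -/
theorem AddCommGroup.exists_addMonoidHom_real_ne_zero {G : Type*} [AddCommGroup G]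
    [IsAddTorsionFree G] {κ : Type*} [Countable κ] (g : κ → G)
    (hg : ∀ k, g k ≠ 0) : ∃ l : G →+ ℝ, ∀ k, l (g k) ≠ 0 := by
  let v : κ → DivisibleHull G := fun k => g k
  let S := Submodule.span ℚ (Set.range v)
  have hrank : Cardinal.lift.{0} (Module.rank ℚ S) < Cardinal.lift (Module.rank ℚ ℝ) := by
    rw [Real.rank_rat_real, Cardinal.lift_continuum, Cardinal.lift_id']
    exact ((rank_span_le _).trans (Set.countable_range v).le_aleph0).trans_lt
      Cardinal.aleph0_lt_continuum
  obtain ⟨φ, hφ⟩ := Module.Free.exists_linearMap_injective_of_lift_rank_lt hrank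
  obtain ⟨ψ, hψ⟩ := φ.exists_extend
  refine ⟨ψ.toAddMonoidHom.comp (DivisibleHull.coeAddMonoidHom G), fun k h0 => hg k ?_⟩
  have hk : v k ∈ S := Submodule.subset_span ⟨k, rfl⟩
  have h1 : φ ⟨v k, hk⟩ = 0 := by
    rw [← hψ]
    exact h0
  have h2 : v k = 0 := congrArg Subtype.val ((map_eq_zero_iff φ hφ).1 h1)
  exact (map_eq_zero_iff (DivisibleHull.coeAddMonoidHom G) DivisibleHull.coe_injective).1 h2

namespace GenSeries

open HahnSeries Function

section AxSchanuel

variable {G : Type*} [AddCommGroup G] [LinearOrder G] [IsOrderedAddMonoid G]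

theorem isStronglyLinear_eulerDerivation (l : G →+ ℝ) :
    IsStronglyLinear (eulerDerivation l : Series G → Series G) := fun a =>
  (hasSeriesSum_mono (eulerDerivation l a)).congr fun g => by
    ext k
    simp only [coeff_eulerDerivation, HahnSeries.coeff_smul, mono, coeff_single, smul_eq_mul]
    split_ifs with h
    · rw [h]
      ring
    · simp

/-- The exponential on the valuation ring satisfies Ax's transcendence statement: apply the
differential form of it to the Euler derivation of a homomorphism `G → ℝ` that is generic with
respect to the countably many integral combinations of the series. -/
theorem card_add_one_le_trdeg {ι : Type*} [Fintype ι] [Nonempty ι] (y : ι → Series G)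
    (hy : ∀ i, InValuationRing (y i))
    (hind : LinearIndependent ℚ fun i => y i - C ((y i).coeff 0)) :
    ((Fintype.card ι + 1 : ℕ) : Cardinal) ≤ Algebra.trdeg ℝ
      (IntermediateField.adjoin ℝ (Set.range y ∪ Set.range fun i => sexp (y i))) := by
  -- A nonzero integral combination of the `y i` is not constant.
  have hsum : ∀ m : {m : ι → ℤ // m ≠ 0}, ∃ g : G, g ≠ 0 ∧
      (∑ i, (m.1 i : Series G) * y i).coeff g ≠ 0 := by
    rintro ⟨m, hm⟩
    by_contra! h0
    have h1 : ∑ i, (m i : Series G) * (y i - C ((y i).coeff 0)) = 0 := by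
      have h2 : ∑ i, (m i : Series G) * (y i - C ((y i).coeff 0))
          = ∑ i, (m i : Series G) * y i - C (∑ i, m i * (y i).coeff 0) := by
        simp only [mul_sub, Finset.sum_sub_distrib, map_sum, map_mul, map_intCast]
      ext g
      rw [coeff_zero]
      obtain rfl | hg := eq_or_ne g 0
      · rw [coeff_sum]
        refine Finset.sum_eq_zero fun i _ => ?_
        rw [← map_intCast (C : ℝ →+* Series G), C_mul_eq_smul, HahnSeries.coeff_smul]
        simp
      · rw [h2, coeff_sub, h0 g hg, C_apply, coeff_single_of_ne hg, sub_zero]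
    refine hm (funext fun i => ?_)
    have h3 := Fintype.linearIndependent_iff.1 hind (fun i => (m i : ℚ)) (by
      rw [← h1]
      exact Finset.sum_congr rfl fun i _ => by rw [Int.cast_smul_eq_zsmul, zsmul_eq_mul]) i
    exact_mod_cast h3
  choose g hg hc using hsum
  obtain ⟨l, hl⟩ := AddCommGroup.exists_addMonoidHom_real_ne_zero g hg
  refine (eulerDerivation l : Derivation ℝ (Series G) (Series G)).card_add_one_le_trdeg
    (y := y) (z := fun i => sexp (y i)) (fun i => sexp_ne_zero (hy i))
    (fun i => (isStronglyLinear_eulerDerivation l).map_sexp (hy i)) (fun m h0 => ?_) _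
    (fun i => IntermediateField.subset_adjoin _ _ (.inl ⟨i, rfl⟩))
    fun i => IntermediateField.subset_adjoin _ _ (.inr ⟨i, rfl⟩)
  by_contra hm
  have h1 : eulerDerivation l (∑ i, (m i : Series G) * y i) = 0 := by
    rw [← h0, map_sum]
    refine Finset.sum_congr rfl fun i _ => ?_
    rw [Derivation.leibniz, Derivation.map_intCast, smul_zero, add_zero, smul_eq_mul]
  have h2 := coeff_eulerDerivation l (∑ i, (m i : Series G) * y i) (g ⟨m, hm⟩)
  rw [h1, coeff_zero] at h2
  exact mul_ne_zero (hl ⟨m, hm⟩) (hc ⟨m, hm⟩) h2.symm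

end AxSchanuel

end GenSeries

theorem mainTheorem2 :
    -- the exponential on the valuation ring, for an arbitrary value group
    (∀ (G : Type u) [AddCommGroup G] [LinearOrder G] [IsOrderedAddMonoid G],
      (∀ ε : GenSeries.Series G, GenSeries.Infinitesimal ε →
        GenSeries.HasSeriesSum (fun k : ℕ => ((k.factorial : ℕ) : ℝ)⁻¹ • ε ^ k)
          (GenSeries.sexp ε)) ∧
      (∀ (r : ℝ) (ε : GenSeries.Series G), GenSeries.Infinitesimal ε →
        GenSeries.sexp (HahnSeries.C r + ε) =
          HahnSeries.C (Real.exp r) * GenSeries.sexp ε) ∧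
      (∀ x y : GenSeries.Series G, GenSeries.InValuationRing x → GenSeries.InValuationRing y →
        GenSeries.sexp (x + y) = GenSeries.sexp x * GenSeries.sexp y) ∧
      (∀ y : GenSeries.Series G, GenSeries.InValuationRing y → GenSeries.sexp y ≠ 0)) ∧
    -- series derivations are derivations and are compatible with the exponential
    (∀ (G : Type u) [AddCommGroup G] [LinearOrder G] [IsOrderedAddMonoid G]
      (Φ : Type v) [LinearOrder Φ] (ι : G →+o GenSeries.HahnGroup Φ),
      Function.Injective ι →
      ∀ D : GenSeries.Series G → GenSeries.Series G, GenSeries.IsSeriesDerivation ι D →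
        (∃ δ : Derivation ℝ (GenSeries.Series G) (GenSeries.Series G), ∀ x, δ x = D x) ∧
        ∀ y : GenSeries.Series G, GenSeries.InValuationRing y →
          D y = D (GenSeries.sexp y) / GenSeries.sexp y) ∧
    -- Ax's transcendence statement, for an arbitrary value group
    (∀ (G : Type u) [AddCommGroup G] [LinearOrder G] [IsOrderedAddMonoid G]
      (n : ℕ), 1 ≤ n → ∀ y : Fin n → GenSeries.Series G,
      (∀ i, GenSeries.InValuationRing (y i)) →
      LinearIndependent ℚ (fun i => y i - HahnSeries.C ((y i).coeff 0)) →
      ((n + 1 : ℕ) : Cardinal) ≤ Algebra.trdeg ℝ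
        (IntermediateField.adjoin ℝ
          (Set.range y ∪ Set.range fun i => GenSeries.sexp (y i)))) ∧
    -- right shifts
    (∀ (Φ : Type u) [LinearOrder Φ] (σ : Φ → Φ), StrictMono σ → (∀ φ, φ < σ φ) →
      GenSeries.ExtendsToSeriesDerivation fun φ => -GenSeries.atom (σ φ) 1) ∧
    -- subsets of the real line with a greatest element
    (∀ (Φ : Type u) [LinearOrder Φ] (f : Φ ↪o ℝ) (φM : Φ), (∀ φ, φ ≤ φM) →
      GenSeries.ExtendsToSeriesDerivation fun φ => GenSeries.atom φM (f φ)) ∧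
    -- subsets of the real line without a greatest element
    (∀ (Φ : Type u) [LinearOrder Φ] (f : Φ ↪o ℝ) (w : ℕ → Φ), (∀ φ, f φ < 0) →
      StrictMono w → (∀ φ, ∃ n, φ ≤ w n) →
      GenSeries.ExtendsToSeriesDerivation fun φ => GenSeries.atom (GenSeries.rightEnd w φ) (f φ)) ∧
    -- the data of the preceding clause exist
    (∀ (Φ : Type u) [LinearOrder Φ] [Nonempty Φ] [NoMaxOrder Φ], Nonempty (Φ ↪o ℝ) →
      (∃ f : Φ ↪o ℝ, ∀ φ, f φ < 0) ∧ ∃ w : ℕ → Φ, StrictMono w ∧ ∀ φ, ∃ n, φ ≤ w n) := by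
  open GenSeries in
  refine ⟨fun G _ _ _ => ⟨fun ε hε => ?_, fun r ε hε => ?_, fun x y => sexp_add,
      fun y => sexp_ne_zero⟩, fun G _ _ _ Φ _ ι _ D hD => ⟨?_, fun y hy => ?_⟩,
    fun G _ _ _ n hn y hy hind => ?_,
    fun Φ _ σ hσ hσ' => (isAdmissible_neg_atom hσ hσ').extendsToSeriesDerivation,
    fun Φ _ f φM hM => (isAdmissible_atom_top f hM).extendsToSeriesDerivation,
    fun Φ _ f w hf hw hcof => (isAdmissible_atom_rightEnd f hf hw hcof).extendsToSeriesDerivation,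
    fun Φ _ _ _ ⟨e⟩ => ⟨exists_negative_embedding e, exists_strictMono_cofinal e⟩⟩
  · rw [hε.sexp_eq]
    exact hε.hasSeriesSum_expInf
  · rw [hε.sexp_eq, sexp_C_add r hε]
  · exact ⟨hD.isStronglyLinear.toDerivation hD.map_mono_add, fun _ => rfl⟩
  · rw [eq_div_iff (sexp_ne_zero hy), mul_comm]
    exact (IsStronglyLinear.map_sexp (δ := hD.isStronglyLinear.toDerivation hD.map_mono_add)
      hD.isStronglyLinear hy).symm
  · have : Nonempty (Fin n) := ⟨⟨0, hn⟩⟩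
    simpa only [Fintype.card_fin] using card_add_one_le_trdeg y hy hind
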